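/- **Setting.** Let $0\le A<B$ and let the customer types $v\in\mathcal V=[A,B]$ be distributed according to a probability measure on $[A,B]$ with continuous distribution function $\mathcal G$. Let $N>0$, let $L\ge 1$ and let $0=P_0<P_1<\dots<P_{L-1}$ be the admission prices of queues $0,\dots,L-1$ (higher index means strict priority). Let $g:[0,\infty)\to\mathbb R$ be differentiable and strictly increasing with $g(0)=0$. Let $n,m:[A,B]\to[0,\infty)$ be continuous, and differentiable on $(A,B)$, with $n$ strictly increasing and $m'_v<0$ on $(A,B)$. Assume that $N\int_A^B d\mathcal G(x)/n_x$ lies in the range of $g$ (this holds if it is finite and $g$ is unbounded). A policy $(T_l,q_l)_{l=0}^{L-1}$ consists of measurable arrival times $T_l(v)\ge 0$ and joining probabilities $q_l(v)\ge0$, $\sum_l q_l(v)=1$. Put $$F_l(t)=\int_{\mathcal V}\mathbf 1_{T_l(v)\ge t}\,q_l(v)\,d\mathcal G(v),\qquad c_v(l,t)=m_vP_l+N\sum_{j=l+1}^{L-1}F_j(0)+NF_l(t)+n_v g(t),\qquad c_l(v)=c_v(l,T_l(v)).$$ The policy is a Nash equilibrium (NE) if for every $v\in\mathcal V$ and every $l$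 the time $T_l(v)$ minimizes $c_v(l,t)$ over $t\ge0$, and for every $v\in\mathcal V$ the vector $(q_l(v))_l$ minimizes $\sum_l r_l c_l(v)$ over all probability vectors $(r_l)_l$. **Assumptions.** * (A1) $\int_A^B d\mathcal G(x)/n_x<\infty$, and $y(v)=\dfrac{n_v'}{-m_v'}\displaystyle\int_v^B\frac{d\mathcal G(x)}{n_x}$ is bounded on $(A,B)$. * (A2) $P_{l+1}-P_l>N\max\{\sup_{A<v<B}y(v),\,2/m_A\}$ for $0\le l\le L-2$. * (A3) In every NE all queues are occupied, i.e. $F_l(0)>0$ for all $l$, and $m_B(P_{l+1}-P_l)<NF_l(0)$ for $0\le l\le L-2$. **Theorem.** There are thresholds $A=v_0<v_1<\dots<v_{L-1}<v_L=B$ such that the following holds. 1. There is a NE with $q_l(v)=\mathbf 1_{v_l<v\le v_{l+1}}$ for all $v\in(A,B]$ and all $l$; it is in pure strategies. 2. The NE is unique up to the choice of the finitely many threshold types: in every NE, $q_l(v)=\mathbf 1_{v_l<v\le v_{l+1}}$ for all $l$ and all $v\in\mathcal V\setminus\{v_0,\dots,v_{L-1}\}$, and for every $v\in\mathcal V$,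 $q_l(v)\ne0$ only if $v_l\le v\le v_{l+1}$. Any two NE have the same arrival times $T_l(v)$, for all $l$ and all $v\in\mathcal V$ with $n_v>0$. 3. In every NE and for each $1\le l\le L-1$, the equation $c_{l-1}(v)=c_l(v)$ has exactly one solution in $[A,B]$, namely $v=v_l$. -/

import Mathlib

open MeasureTheory Set

noncomputable section

/-- The boarding game with `L` strict-priority FCFS queues (queue `l + 1` is served before queue
`l`): the data, and the standing assumptions on them. -/
structure BoardingGame (L : ℕ) [NeZero L] where
  /-- The set of customer types is `[A, B]`. -/
  A : ℝ
  B : ℝ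
  A_nonneg : 0 ≤ A
  A_lt_B : A < B
  /-- The distribution of types, carried by `[A, B]`, with a continuous distribution function. -/
  μ : Measure ℝ
  isProb : IsProbabilityMeasure μ
  null_singleton : ∀ x, μ {x} = 0
  carried : μ (Icc A B)ᶜ = 0
  /-- The number of customers. -/
  N : ℝ
  N_pos : 0 < N
  /-- The admission prices. -/
  P : Fin L → ℝ
  P_zero : P 0 = 0
  P_strictMono : StrictMono P
  /-- The cost `g t` of waiting for a time `t ≥ 0`. -/
  g : ℝ → ℝ
  g_zero : g 0 = 0
  g_strictMono : StrictMonoOn g (Ici 0)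
  g_diff : DifferentiableOn ℝ g (Ici 0)
  /-- The weight of the waiting cost for a type. It is positive except possibly at `A`. -/
  n : ℝ → ℝ
  n_nonneg : 0 ≤ n A
  n_strictMono : StrictMonoOn n (Icc A B)
  n_cont : ContinuousOn n (Icc A B)
  n_diff : DifferentiableOn ℝ n (Ioo A B)
  /-- The weight of money for a type. -/
  m : ℝ → ℝ
  m_nonneg : ∀ v ∈ Icc A B, 0 ≤ m v
  m_cont : ContinuousOn m (Icc A B)
  m_diff : DifferentiableOn ℝ m (Ioo A B)
  m_deriv_neg : ∀ v ∈ Ioo A B, deriv m v < 0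

/-- A policy: a type `v` who joins queue `l` arrives `T l v` time units before boarding starts, and
a type `v` joins queue `l` with probability `q l v`. Only types in `[A, B]` matter. -/
structure Policy (L : ℕ) where
  T : Fin L → ℝ → ℝ
  q : Fin L → ℝ → ℝ

namespace BoardingGame

variable {L : ℕ} [NeZero L] (G : BoardingGame L)

/-- The fraction of customers who join queue `l` and wait there for a time `t` or longer. -/
def F (σ : Policy L) (l : Fin L) (t : ℝ) : ℝ :=
  ∫ v in Icc G.A G.B, {v | t ≤ σ.T l v}.indicator (σ.q l) v ∂G.μ

/-- The cost `c_v(l, t)` for type `v` of joining queue `l` at time `t` before boarding, when the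
population follows the policy `σ`. -/
def cost (σ : Policy L) (v : ℝ) (l : Fin L) (t : ℝ) : ℝ :=
  G.m v * G.P l + G.N * ∑ j ∈ Finset.Ioi l, G.F σ j 0 + G.N * G.F σ l t + G.n v * G.g t

/-- The cost `c_l(v) = c_v(l, T_l(v))` of joining queue `l` at the arrival time set by `σ`. -/
def joinCost (σ : Policy L) (l : Fin L) (v : ℝ) : ℝ :=
  G.cost σ v l (σ.T l v)

/-- Nash equilibrium: against the population that follows `σ`, every type chooses in every queue
an optimal arrival time, and an optimal randomization over the queues. -/
structure IsNash (σ : Policy L) : Prop where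
  aemeasurable_T : ∀ l, AEMeasurable (σ.T l) G.μ
  aemeasurable_q : ∀ l, AEMeasurable (σ.q l) G.μ
  T_nonneg : ∀ v ∈ Icc G.A G.B, ∀ l, 0 ≤ σ.T l v
  T_argmin : ∀ v ∈ Icc G.A G.B, ∀ l, IsMinOn (G.cost σ v l) (Ici 0) (σ.T l v)
  q_mem : ∀ v ∈ Icc G.A G.B, (fun l => σ.q l v) ∈ stdSimplex ℝ (Fin L)
  q_argmin : ∀ v ∈ Icc G.A G.B,
    IsMinOn (fun r : Fin L → ℝ => ∑ l, r l * G.joinCost σ l v) (stdSimplex ℝ (Fin L))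
      (fun l => σ.q l v)

/-- `∫_v^B d𝒢(x) / n_x`. -/
def invWeight (v : ℝ) : ℝ :=
  ∫ x in Icc v G.B, 1 / G.n x ∂G.μ

/-- `y(v) = n_v' / (-m_v') * ∫_v^B d𝒢(x) / n_x`, used for `A < v < B`. -/
def y (v : ℝ) : ℝ :=
  deriv G.n v / (-deriv G.m v) * G.invWeight v

/-- `y` is bounded, and `∫_A^B d𝒢(x) / n_x` is finite. -/
def A1 : Prop :=
  (∃ C, ∀ v ∈ Ioo G.A G.B, |G.y v| ≤ C) ∧
    IntegrableOn (fun x => 1 / G.n x) (Icc G.A G.B) G.μ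

/-- Lower bound on the price differences of adjacent queues. -/
def A2 : Prop :=
  ∀ (l : ℕ) (h : l + 1 < L),
    G.N * max (sSup (G.y '' Ioo G.A G.B)) (2 / G.m G.A) <
      G.P ⟨l + 1, h⟩ - G.P ⟨l, Nat.lt_of_succ_lt h⟩

/-- In equilibrium all queues are occupied, and `P_{l+1} - P_l < N F_l(0) / m_B`, where the right
side is read as `∞` if `m_B = 0`. -/
def A3 : Prop :=
  ∀ σ : Policy L, G.IsNash σ →
    (∀ l, 0 < G.F σ l 0) ∧
    ∀ (l : ℕ) (h : l + 1 < L),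
      G.m G.B * (G.P ⟨l + 1, h⟩ - G.P ⟨l, Nat.lt_of_succ_lt h⟩) <
        G.N * G.F σ ⟨l, Nat.lt_of_succ_lt h⟩ 0

/-- `g⁻¹(N ∫_A^B d𝒢(x) / n_x)` makes sense (automatic if `g` is unbounded). -/
def WaitRange : Prop :=
  ∃ t, 0 ≤ t ∧ G.g t = G.N * G.invWeight G.A

end BoardingGame

end

/-! Eliminating the arrival times turns the game into one about queue choices alone. In a single
queue joined with probability `f`, optimal times decrease in the type and have no atoms, so type `v`
finds ahead of it exactly the mass `cum f v` of the types up to `v`. The optimality inequalities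
then force `g (τ v) = N * tail f v` when `n v > 0`, with `tail f v` the integral of `f / n` above
`v`. The resulting congestion and waiting cost is `N * load f v`, whose kernel is `min 1 (n v / n
x)`; conversely, these times form an equilibrium (`IsTiming.cost_eq`, `IsShare.exists_isTiming`).

The reduced costs are affine in the queue choices, with a monotone linear part on `L²`. Symmetrizing
the kernel gives `1 + min / max`, and `min / max` is a Gram kernel, so each queue contributes at
least half the square of its mass. Together with the priority terms this leaves half the square of
the total mass, which is nonnegative. A variational inequality then yields choices that are optimal
for almost every type (`exists_ae_bestReply`).

By (A1) and (A2), the cost of a higher queue minus that of a lower one is strictly decreasing in the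
type. Ties are therefore null, and redefining the choice at every type as the first optimal queue
changes no cost: this gives an equilibrium. The difference for adjacent queues is positive at `A` by
(A2) and negative at `B` by (A3), so it vanishes at one threshold, and occupied queues make the
thresholds strictly increasing.

For uniqueness, indifference at a threshold expresses the mass of the queue below it through this
threshold and the next one, strictly decreasingly (`massBelow_lt`). If a threshold of one
equilibrium is smaller than that of another, and the next one is not larger, then the previous one
is smaller too; descending to the common end `A` gives a contradiction. Hence thresholds agree,
choices agree almost everywhere, and so do arrival times of types with `n v > 0`. -/

/-! ### Affine variational inequalities in Hilbert space -/

section VariationalInequality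

open Filter Topology

open scoped RealInnerProductSpace

variable {H : Type*} [NormedAddCommGroup H] [InnerProductSpace ℝ H] [CompleteSpace H]

/-- The nearest-point map of a nonempty closed convex set, by its variational characterization. -/
theorem exists_nearestPoint {K : Set H} (hne : K.Nonempty) (hcl : IsClosed K)
    (hcv : Convex ℝ K) : ∃ p : H → H, (∀ x, p x ∈ K) ∧ ∀ x, ∀ w ∈ K, ⟪x - p x, w - p x⟫ ≤ 0 := by
  have h : ∀ x : H, ∃ y ∈ K, ∀ w ∈ K, ⟪x - y, w - y⟫ ≤ 0 := fun x => by
    obtain ⟨y, hy, hxy⟩ := exists_norm_eq_iInf_of_complete_convex hne hcl.isComplete hcv x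
    exact ⟨y, hy, (norm_eq_iInf_iff_real_inner_le_zero hcv hy).1 hxy⟩
  choose p hp hp' using h
  exact ⟨p, hp, hp'⟩

theorem norm_sub_le_of_nearestPoint {H : Type*} [NormedAddCommGroup H] [InnerProductSpace ℝ H]
    {x y a b : H} (ha : ⟪x - a, b - a⟫ ≤ 0)
    (hb : ⟪y - b, a - b⟫ ≤ 0) : ‖a - b‖ ≤ ‖x - y‖ := by
  have h : ‖a - b‖ * ‖a - b‖ ≤ ‖x - y‖ * ‖a - b‖ := by
    refine le_trans ?_ (real_inner_le_norm (x - y) (a - b))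
    rw [← real_inner_self_eq_norm_mul_norm]
    have e : ⟪x - y, a - b⟫ - ⟪a - b, a - b⟫ = -⟪x - a, b - a⟫ - ⟪y - b, a - b⟫ := by
      simp only [inner_sub_left, inner_sub_right]; ring
    linarith
  rcases (norm_nonneg (a - b)).eq_or_lt with h0 | h0
  · rw [← h0]; exact norm_nonneg _
  · exact le_of_mul_le_mul_right h h0

/-- Lions–Stampacchia: an affine variational inequality with a coercive linear part has a
solution on every nonempty closed convex set. -/
theorem exists_variational_of_coercive (Λ : H →L[ℝ] H) (b : H) {K : Set H} (hne : K.Nonempty)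
    (hcl : IsClosed K) (hcv : Convex ℝ K) {ε : ℝ} (hε : 0 < ε)
    (hco : ∀ x, ε * ‖x‖ ^ 2 ≤ ⟪Λ x, x⟫) : ∃ q ∈ K, ∀ r ∈ K, 0 ≤ ⟪Λ q + b, r - q⟫ := by
  obtain ⟨p, hpK, hp⟩ := exists_nearestPoint hne hcl hcv
  -- The solution is a fixed point of the projected step `x ↦ p (x - t • (Λ x + b))`. Adding `ε`
  -- makes `M` positive and at least `ε`; the choice `t = ε / M ^ 2` minimizes `1 - 2 * t * ε + t ^
  -- 2 * M ^ 2`, the bound on the squared Lipschitz constant.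
  set M : ℝ := ‖Λ‖ + ε with hM
  have hMpos : 0 < M := by positivity
  set t : ℝ := ε / M ^ 2 with ht
  have htpos : 0 < t := by positivity
  have hεM : ε ^ 2 / M ^ 2 ≤ 1 := by
    rw [div_le_one (by positivity)]
    gcongr
    rw [hM]
    linarith [norm_nonneg Λ]
  have hlip : ∀ x y, ‖p (x - t • (Λ x + b)) - p (y - t • (Λ y + b))‖
      ≤ √(1 - ε ^ 2 / M ^ 2) * ‖x - y‖ := by
    intro x y
    refine (norm_sub_le_of_nearestPoint (hp _ _ (hpK _)) (hp _ _ (hpK _))).trans ?_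
    have e : x - t • (Λ x + b) - (y - t • (Λ y + b)) = (x - y) - t • Λ (x - y) := by
      rw [map_sub, smul_add, smul_add, smul_sub]; abel
    rw [e]
    refine abs_le_of_sq_le_sq' ?_ (by positivity) |>.2
    rw [mul_pow, Real.sq_sqrt (by linarith), norm_sub_sq_real, norm_smul, inner_smul_right,
      real_inner_comm, mul_pow, Real.norm_eq_abs, sq_abs]
    have h1 := hco (x - y)
    have h2 : ‖Λ (x - y)‖ ^ 2 ≤ M ^ 2 * ‖x - y‖ ^ 2 := by
      rw [← mul_pow]
      gcongr
      refine (Λ.le_opNorm _).trans ?_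
      gcongr
      rw [hM]; linarith
    have h3 : t ^ 2 * ‖Λ (x - y)‖ ^ 2 ≤ t ^ 2 * (M ^ 2 * ‖x - y‖ ^ 2) := by gcongr
    have h4 : t * (ε * ‖x - y‖ ^ 2) ≤ t * ⟪Λ (x - y), x - y⟫ := by gcongr
    have e1 : t ^ 2 * (M ^ 2 * ‖x - y‖ ^ 2) = ε ^ 2 / M ^ 2 * ‖x - y‖ ^ 2 := by
      rw [ht]; field_simp
    have e2 : t * (ε * ‖x - y‖ ^ 2) = ε ^ 2 / M ^ 2 * ‖x - y‖ ^ 2 := by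
      rw [ht]; field_simp
    linarith
  have hcontr : ContractingWith (√(1 - ε ^ 2 / M ^ 2)).toNNReal
      (fun x => p (x - t • (Λ x + b))) := by
    refine ⟨?_, LipschitzWith.of_dist_le_mul fun x y => ?_⟩
    · rw [Real.toNNReal_lt_one, Real.sqrt_lt' one_pos]
      have : 0 < ε ^ 2 / M ^ 2 := by positivity
      linarith
    · rw [dist_eq_norm, dist_eq_norm, Real.coe_toNNReal _ (Real.sqrt_nonneg _)]
      exact hlip x y
  have hfix := hcontr.fixedPoint_isFixedPt
  set q := hcontr.fixedPoint
  have hq : p (q - t • (Λ q + b)) = q := hfix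
  refine ⟨q, hq ▸ hpK _, fun r hr => ?_⟩
  have h := hp (q - t • (Λ q + b)) r hr
  rw [hq, sub_sub_cancel_left, inner_neg_left, inner_smul_left] at h
  simp only [conj_trivial] at h
  exact nonneg_of_mul_nonneg_right (by linarith) htpos

/-- An affine variational inequality with a monotone linear part has a solution on every nonempty
bounded closed convex set. -/
theorem exists_variational_of_monotone (Λ : H →L[ℝ] H) (b : H) {K : Set H} (hne : K.Nonempty)
    (hcl : IsClosed K) (hcv : Convex ℝ K) (hbd : Bornology.IsBounded K)
    (hmon : ∀ x, 0 ≤ ⟪Λ x, x⟫) : ∃ q ∈ K, ∀ r ∈ K, 0 ≤ ⟪Λ q + b, r - q⟫ := by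
  have key : ∀ j : ℕ, ∃ q ∈ K, ∀ r ∈ K,
      0 ≤ ⟪Λ q + (1 / ((j : ℝ) + 1)) • q + b, r - q⟫ := by
    intro j
    have hε : 0 < 1 / ((j : ℝ) + 1) := by positivity
    obtain ⟨q, hq, h⟩ := exists_variational_of_coercive
      (Λ + (1 / ((j : ℝ) + 1)) • ContinuousLinearMap.id ℝ H) b hne hcl hcv hε (fun x => by
        simp only [add_apply, smul_apply,
          ContinuousLinearMap.id_apply, inner_add_left, inner_smul_left, conj_trivial,
          real_inner_self_eq_norm_sq]
        linarith [hmon x])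
    exact ⟨q, hq, by simpa using h⟩
  choose q hqK hq using key
  -- Norms of the regularized solutions increase, and their increments control distances.
  -- Boundedness of `K` thus gives strong convergence without weak compactness.
  have hdiff : ∀ i j, i ≤ j → ‖q i - q j‖ ^ 2 ≤ ‖q j‖ ^ 2 - ‖q i‖ ^ 2 := by
    intro i j hij
    set ε : ℝ := 1 / ((i : ℝ) + 1)
    set δ : ℝ := 1 / ((j : ℝ) + 1)
    have hδ : 0 < δ := by positivity
    have hεδ : δ ≤ ε := by
      refine one_div_le_one_div_of_le (by positivity) ?_
      have : (i : ℝ) ≤ j := by exact_mod_cast hij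
      linarith
    have h1 := hq i (q j) (hqK j)
    have h2 := hq j (q i) (hqK i)
    have h3 := hmon (q i - q j)
    simp only [map_sub, inner_sub_left, inner_sub_right, inner_add_left, inner_smul_left,
      conj_trivial, real_inner_self_eq_norm_sq] at h1 h2 h3
    have hsq := norm_sub_sq_real (q i) (q j)
    have hcomm := real_inner_comm (q i) (q j)
    have hn : 0 ≤ ‖q i - q j‖ ^ 2 := by positivity
    -- Test each inequality with the other solution, add, drop the monotone term, and polarize.
    have hmain : (ε + δ) * ‖q i - q j‖ ^ 2 ≤ (ε - δ) * (‖q j‖ ^ 2 - ‖q i‖ ^ 2) := by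
      rw [show 1 / ((i : ℝ) + 1) = ε from rfl] at h1
      rw [hcomm, show 1 / ((j : ℝ) + 1) = δ from rfl] at h2
      rw [hsq]
      linarith
    have hpos : 0 ≤ (ε - δ) * (‖q j‖ ^ 2 - ‖q i‖ ^ 2) := le_trans (by positivity) hmain
    rcases hεδ.eq_or_lt with h | h
    · rw [h, sub_self, zero_mul] at hmain
      have hz : ‖q i - q j‖ ^ 2 = 0 := by
        refine le_antisymm ?_ hn
        by_contra! hc
        have : 0 < (ε + ε) * ‖q i - q j‖ ^ 2 := by positivity
        linarith
      have : q i = q j := by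
        rw [← sub_eq_zero, ← norm_eq_zero]; exact pow_eq_zero_iff (two_ne_zero) |>.1 hz
      rw [hz, this, sub_self]
    · have h4 : 0 ≤ ‖q j‖ ^ 2 - ‖q i‖ ^ 2 := nonneg_of_mul_nonneg_right hpos (sub_pos.2 h)
      have h5 : (ε - δ) * (‖q j‖ ^ 2 - ‖q i‖ ^ 2) ≤ (ε + δ) * (‖q j‖ ^ 2 - ‖q i‖ ^ 2) := by
        gcongr; linarith
      exact le_of_mul_le_mul_left (hmain.trans h5) (by positivity)
  have hmono : Monotone fun j => ‖q j‖ ^ 2 := fun i j hij => by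
    have := hdiff i j hij
    have h0 : 0 ≤ ‖q i - q j‖ ^ 2 := by positivity
    change ‖q i‖ ^ 2 ≤ ‖q j‖ ^ 2
    linarith
  obtain ⟨R, hR⟩ := hbd.exists_norm_le
  have hbdd : BddAbove (range fun j => ‖q j‖ ^ 2) := by
    refine ⟨R ^ 2, ?_⟩
    rintro _ ⟨j, rfl⟩
    exact pow_le_pow_left₀ (norm_nonneg _) (hR _ (hqK j)) 2
  have hcau := (tendsto_atTop_ciSup hmono hbdd).cauchySeq
  have hqcau : CauchySeq q := by
    rw [Metric.cauchySeq_iff'] at hcau ⊢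
    intro e he
    obtain ⟨n₀, hn₀⟩ := hcau (e ^ 2) (by positivity)
    refine ⟨n₀, fun j hj => ?_⟩
    have h := hn₀ j hj
    rw [Real.dist_eq] at h
    rw [dist_comm, dist_eq_norm]
    have h2 := (hdiff n₀ j hj).trans_lt ((le_abs_self _).trans_lt h)
    exact lt_of_pow_lt_pow_left₀ 2 he.le h2
  obtain ⟨q', hq'⟩ := cauchySeq_tendsto_of_complete hqcau
  refine ⟨q', hcl.mem_of_tendsto hq' (Eventually.of_forall hqK), fun r hr => ?_⟩
  have hlim : Tendsto (fun j : ℕ => ⟪Λ (q j) + (1 / ((j : ℝ) + 1)) • q j + b, r - q j⟫) atTop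
      (𝓝 ⟪Λ q' + (0 : ℝ) • q' + b, r - q'⟫) :=
    ((((Λ.continuous.tendsto q').comp hq').add
      (tendsto_one_div_add_atTop_nhds_zero_nat.smul hq')).add_const b).inner
      (hq'.const_sub r)
  rw [zero_smul, add_zero] at hlim
  exact ge_of_tendsto' hlim fun j => hq j r hr

end VariationalInequality

/-! ### Positivity of the ratio kernels -/

section RatioKernel

variable {Ω : Type*} [MeasurableSpace Ω] {μ : Measure Ω} [IsProbabilityMeasure μ]

/-- The indicator of `(0, a²)`, divided by `a`. -/
noncomputable def invLevel (a r : ℝ) : ℝ :=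
  if 0 < r ∧ r < a ^ 2 then a⁻¹ else 0

theorem invLevel_mul_invLevel (a b r : ℝ) : invLevel a r * invLevel b r
    = (Ioo 0 (min (a ^ 2) (b ^ 2))).indicator (fun _ => a⁻¹ * b⁻¹) r := by
  simp only [invLevel, indicator_apply, mem_Ioo, lt_min_iff]
  split_ifs <;> first | rfl | simp_all

theorem invLevel_nonneg {a : ℝ} (ha : 0 ≤ a) (r : ℝ) : 0 ≤ invLevel a r := by
  unfold invLevel
  split_ifs
  · exact inv_nonneg.2 ha
  · exact le_rfl

/-- The overlap of the two supports has length `(min a b) ^ 2`, and `a * b = min a b * max a b`.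
This exhibits the kernel as a Gram kernel in `L²` of the line. -/
theorem integral_level_mul_level {a b : ℝ} (ha : 0 < a) (hb : 0 < b) :
    ∫ r : ℝ, invLevel a r * invLevel b r
      = min a b / max a b := by
  simp only [invLevel_mul_invLevel]
  rw [integral_indicator measurableSet_Ioo, setIntegral_const, measureReal_def, Real.volume_Ioo,
    sub_zero, ENNReal.toReal_ofReal (by positivity), smul_eq_mul]
  rcases le_total a b with h | h
  · rw [min_eq_left h, max_eq_right h, min_eq_left (by gcongr)]
    field_simp
  · rw [min_eq_right h, max_eq_left h, min_eq_right (by gcongr)]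
    field_simp

theorem integrable_level_mul_level (a b : ℝ) :
    Integrable fun r : ℝ =>
      invLevel a r * invLevel b r := by
  simp only [invLevel_mul_invLevel]
  rw [integrable_indicator_iff measurableSet_Ioo]
  exact integrableOn_const (by simp)

theorem min_div_max_le_one {a b : ℝ} (ha : 0 < a) : |min a b / max a b| ≤ 1 ∨ b < 0 := by
  rcases lt_or_ge b 0 with h | h
  · exact Or.inr h
  · left
    have h1 : 0 < max a b := lt_max_of_lt_left ha
    have h2 : 0 ≤ min a b := le_min ha.le h
    rw [abs_of_nonneg (by positivity), div_le_one h1]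
    exact min_le_max

/-- The kernel `min (n v) (n x) / max (n v) (n x)` is positive semidefinite. -/
theorem integral_min_div_max_nonneg {n : Ω → ℝ} (hn : Measurable n) (hpos : ∀ᵐ x ∂μ, 0 < n x)
    {f : Ω → ℝ} (hf : Integrable f μ) :
    0 ≤ ∫ p : Ω × Ω, min (n p.1) (n p.2) / max (n p.1) (n p.2) * (f p.1 * f p.2) ∂μ.prod μ := by
  have hem : Measurable fun z : Ω × ℝ => invLevel (n z.1) z.2 := by
    refine Measurable.ite ?_ ((hn.comp measurable_fst).inv) measurable_const
    exact (measurableSet_lt measurable_const measurable_snd).inter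
      (measurableSet_lt measurable_snd ((hn.comp measurable_fst).pow_const 2))
  have hff : Integrable (fun p : Ω × Ω => f p.1 * f p.2) (μ.prod μ) := hf.mul_prod hf
  have hpos2 : ∀ᵐ p ∂μ.prod μ, 0 < n p.1 ∧ 0 < n p.2 :=
    (Measure.quasiMeasurePreserving_fst.ae hpos).and (Measure.quasiMeasurePreserving_snd.ae hpos)
  have hkm : Measurable fun p : Ω × Ω => min (n p.1) (n p.2) / max (n p.1) (n p.2) := by fun_prop
  have hk : Integrable (fun p : Ω × Ω => min (n p.1) (n p.2) / max (n p.1) (n p.2) *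
      (f p.1 * f p.2)) (μ.prod μ) := by
    refine hff.bdd_mul (c := 1) hkm.aestronglyMeasurable ?_
    filter_upwards [hpos2] with p hp
    exact (min_div_max_le_one hp.1).resolve_right hp.2.not_gt
  have hee : Measurable fun z : (Ω × Ω) × ℝ => invLevel (n z.1.1) z.2 * invLevel (n z.1.2) z.2 :=
    (hem.comp ((measurable_fst.comp measurable_fst).prodMk measurable_snd)).mul
      (hem.comp ((measurable_snd.comp measurable_fst).prodMk measurable_snd))
  have hΨ : Integrable (fun z : (Ω × Ω) × ℝ =>
      invLevel (n z.1.1) z.2 * invLevel (n z.1.2) z.2 * (f z.1.1 * f z.1.2))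
      ((μ.prod μ).prod volume) := by
    have hsm : AEStronglyMeasurable
        (fun z : (Ω × Ω) × ℝ =>
          invLevel (n z.1.1) z.2 * invLevel (n z.1.2) z.2 * (f z.1.1 * f z.1.2))
        ((μ.prod μ).prod volume) :=
      hee.aestronglyMeasurable.mul hff.1.comp_fst
    rw [integrable_prod_iff hsm]
    refine ⟨Filter.Eventually.of_forall fun p =>
      (integrable_level_mul_level (n p.1) (n p.2)).mul_const (f p.1 * f p.2), ?_⟩
    refine hk.norm.congr ?_
    filter_upwards [hpos2] with p hp
    have h1 : ∀ r, ‖invLevel (n p.1) r * invLevel (n p.2) r * (f p.1 * f p.2)‖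
        = invLevel (n p.1) r * invLevel (n p.2) r * ‖f p.1 * f p.2‖ := by
      intro r
      rw [norm_mul, Real.norm_of_nonneg]
      exact mul_nonneg (invLevel_nonneg hp.1.le r) (invLevel_nonneg hp.2.le r)
    simp only [h1]
    rw [integral_mul_const, integral_level_mul_level hp.1 hp.2, norm_mul, Real.norm_of_nonneg]
    exact div_nonneg (le_min hp.1.le hp.2.le) (le_max_of_le_left hp.1.le)
  -- After Fubini the form is the integral over `r` of the square of `∫ v, invLevel (n v) r * f v
  -- ∂μ`.
  have hswap := integral_integral_swap
    (f := fun (p : Ω × Ω) r => invLevel (n p.1) r * invLevel (n p.2) r * (f p.1 * f p.2)) hΨ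
  have hleft : ∫ p : Ω × Ω, min (n p.1) (n p.2) / max (n p.1) (n p.2) * (f p.1 * f p.2) ∂μ.prod μ
      = ∫ p : Ω × Ω, ∫ r, invLevel (n p.1) r * invLevel (n p.2) r * (f p.1 * f p.2) ∂volume
        ∂μ.prod μ := by
    refine integral_congr_ae ?_
    filter_upwards [hpos2] with p hp
    rw [integral_mul_const, integral_level_mul_level hp.1 hp.2]
  rw [hleft, hswap]
  refine integral_nonneg fun r => ?_
  have : ∫ p : Ω × Ω, invLevel (n p.1) r * invLevel (n p.2) r * (f p.1 * f p.2) ∂μ.prod μ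
      = (∫ v, invLevel (n v) r * f v ∂μ) * ∫ v, invLevel (n v) r * f v ∂μ := by
    rw [← integral_prod_mul]
    congr 1
    funext p
    ring
  change 0 ≤ ∫ p : Ω × Ω, invLevel (n p.1) r * invLevel (n p.2) r * (f p.1 * f p.2) ∂μ.prod μ
  rw [this]
  exact mul_self_nonneg _

theorem abs_min_one_div_le {a b : ℝ} (h : 0 ≤ a / b) : |min 1 (a / b)| ≤ 1 := by
  rw [abs_of_nonneg (le_min zero_le_one h)]
  exact min_le_left _ _

/-- One of the two minima is `1`, the other is the smaller ratio. A quadratic form sees only the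
symmetric part of its kernel, so this splits it into a constant and a positive semidefinite kernel.
-/
theorem min_one_div_add_min_one_div {a b : ℝ} (ha : 0 < a) (hb : 0 < b) :
    min 1 (a / b) + min 1 (b / a) = 1 + min a b / max a b := by
  rcases le_total a b with h | h
  · rw [min_eq_right ((div_le_one hb).2 h), min_eq_left ((one_le_div ha).2 h), min_eq_left h,
      max_eq_right h, add_comm]
  · rw [min_eq_left ((one_le_div hb).2 h), min_eq_right ((div_le_one ha).2 h), min_eq_right h,
      max_eq_left h]

/-- The quadratic form of the kernel `min 1 (n v / n x)` is at least that of the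
constant `1 / 2`. -/
theorem half_sq_integral_le {n : Ω → ℝ} (hn : Measurable n) (hpos : ∀ᵐ x ∂μ, 0 < n x)
    {f : Ω → ℝ} (hf : Integrable f μ) :
    (∫ x, f x ∂μ) ^ 2 / 2 ≤ ∫ v, (∫ x, min 1 (n v / n x) * f x ∂μ) * f v ∂μ := by
  have hff : Integrable (fun p : Ω × Ω => f p.1 * f p.2) (μ.prod μ) := hf.mul_prod hf
  have hpos2 : ∀ᵐ p ∂μ.prod μ, 0 < n p.1 ∧ 0 < n p.2 :=
    (Measure.quasiMeasurePreserving_fst.ae hpos).and (Measure.quasiMeasurePreserving_snd.ae hpos)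
  have hρ : Integrable (fun p : Ω × Ω => min 1 (n p.1 / n p.2) * (f p.1 * f p.2)) (μ.prod μ) := by
    refine hff.bdd_mul (c := 1) (Measurable.aestronglyMeasurable (by fun_prop)) ?_
    filter_upwards [hpos2] with p hp
    exact abs_min_one_div_le (div_pos hp.1 hp.2).le
  have hρ' : Integrable (fun p : Ω × Ω => min 1 (n p.2 / n p.1) * (f p.1 * f p.2)) (μ.prod μ) := by
    refine hff.bdd_mul (c := 1) (Measurable.aestronglyMeasurable (by fun_prop)) ?_
    filter_upwards [hpos2] with p hp
    exact abs_min_one_div_le (div_pos hp.2 hp.1).le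
  have hk : Integrable (fun p : Ω × Ω => min (n p.1) (n p.2) / max (n p.1) (n p.2) *
      (f p.1 * f p.2)) (μ.prod μ) := by
    refine hff.bdd_mul (c := 1) (Measurable.aestronglyMeasurable (by fun_prop)) ?_
    filter_upwards [hpos2] with p hp
    exact (min_div_max_le_one hp.1).resolve_right hp.2.not_gt
  have h1 : ∫ v, (∫ x, min 1 (n v / n x) * f x ∂μ) * f v ∂μ
      = ∫ p : Ω × Ω, min 1 (n p.1 / n p.2) * (f p.1 * f p.2) ∂μ.prod μ := by
    rw [integral_prod _ hρ]
    congr 1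
    funext v
    rw [← integral_mul_const]
    congr 1
    funext x
    ring
  have h2 : ∫ p : Ω × Ω, min 1 (n p.2 / n p.1) * (f p.1 * f p.2) ∂μ.prod μ
      = ∫ p : Ω × Ω, min 1 (n p.1 / n p.2) * (f p.1 * f p.2) ∂μ.prod μ := by
    rw [← integral_prod_swap (μ := μ) (ν := μ)]
    congr 1
    funext p
    simp only [Prod.fst_swap, Prod.snd_swap]
    ring
  have h3 : ∫ p : Ω × Ω, min 1 (n p.1 / n p.2) * (f p.1 * f p.2) ∂μ.prod μ
      + ∫ p : Ω × Ω, min 1 (n p.2 / n p.1) * (f p.1 * f p.2) ∂μ.prod μ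
      = (∫ x, f x ∂μ) ^ 2 +
        ∫ p : Ω × Ω, min (n p.1) (n p.2) / max (n p.1) (n p.2) * (f p.1 * f p.2) ∂μ.prod μ := by
    rw [sq, ← integral_prod_mul, ← integral_add hρ hρ', ← integral_add hff hk]
    refine integral_congr_ae ?_
    filter_upwards [hpos2] with p hp
    rw [← add_mul, min_one_div_add_min_one_div hp.1 hp.2]
    ring
  have h4 := integral_min_div_max_nonneg hn hpos hf
  rw [h1]
  linarith

end RatioKernel

/-! ### The congestion operator on `L²` -/

section RatioOperator

variable {Ω : Type*} [MeasurableSpace Ω] {μ : Measure Ω} {n : Ω → ℝ}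

theorem Lp_smul_nonneg {a : ℝ} (ha : 0 ≤ a) {f : Lp ℝ 2 μ} (hf : 0 ≤ f) : 0 ≤ a • f := by
  rw [← Lp.coeFn_nonneg] at hf ⊢
  filter_upwards [hf, Lp.coeFn_smul a f] with x hx h
  rw [h]
  exact mul_nonneg ha hx

theorem integrable_ratio_mul (hn : Measurable n) (h0 : ∀ x, 0 ≤ n x) {f : Ω → ℝ}
    (hf : Integrable f μ) (v : Ω) : Integrable (fun x => min 1 (n v / n x) * f x) μ :=
  hf.bdd_mul (c := 1) (Measurable.aestronglyMeasurable (by fun_prop))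
    (Filter.Eventually.of_forall fun x => abs_min_one_div_le (div_nonneg (h0 v) (h0 x)))

variable [IsProbabilityMeasure μ]

theorem integral_abs_le_norm (f : Lp ℝ 2 μ) : ∫ x, |f x| ∂μ ≤ ‖f‖ := by
  have h1 : ∫ x, ‖f x‖ ∂μ = (eLpNorm f 1 μ).toReal := by
    rw [eLpNorm_one_eq_lintegral_enorm,
      integral_norm_eq_lintegral_enorm (Lp.aestronglyMeasurable f)]
  change ∫ x, ‖f x‖ ∂μ ≤ _
  rw [h1, Lp.norm_def]
  exact ENNReal.toReal_mono (Lp.eLpNorm_ne_top f)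
    (eLpNorm_le_eLpNorm_of_exponent_le (by norm_num) (Lp.aestronglyMeasurable f))

theorem integrable_of_Lp_two (f : Lp ℝ 2 μ) : Integrable f μ :=
  (Lp.memLp f).integrable (by norm_num)

theorem abs_integral_ratio_le (hn : Measurable n) (h0 : ∀ x, 0 ≤ n x) (f : Lp ℝ 2 μ) (v : Ω) :
    |∫ x, min 1 (n v / n x) * f x ∂μ| ≤ ‖f‖ := by
  refine le_trans ?_ (integral_abs_le_norm f)
  refine (abs_integral_le_integral_abs).trans ?_
  refine integral_mono (integrable_ratio_mul hn h0 (integrable_of_Lp_two f) v).abs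
    (integrable_of_Lp_two f).abs fun x => ?_
  change |min 1 (n v / n x) * f x| ≤ |f x|
  rw [abs_mul]
  exact mul_le_of_le_one_left (abs_nonneg _) (abs_min_one_div_le (div_nonneg (h0 v) (h0 x)))

theorem memLp_integral_ratio (hn : Measurable n) (h0 : ∀ x, 0 ≤ n x) (f : Lp ℝ 2 μ) :
    MemLp (fun v => ∫ x, min 1 (n v / n x) * f x ∂μ) 2 μ := by
  refine MemLp.of_bound ?_ ‖f‖ (Filter.Eventually.of_forall (abs_integral_ratio_le hn h0 f))
  refine (StronglyMeasurable.integral_prod_right ?_).aestronglyMeasurable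
  refine Measurable.stronglyMeasurable ?_
  have : Measurable f := (Lp.stronglyMeasurable f).measurable
  change Measurable fun p : Ω × Ω => min 1 (n p.1 / n p.2) * f p.2
  fun_prop

/-- The integral operator on `L²` with kernel `min 1 (n v / n x)`. -/
noncomputable def ratioOp (hn : Measurable n) (h0 : ∀ x, 0 ≤ n x) :
    Lp ℝ 2 μ →L[ℝ] Lp ℝ 2 μ :=
  LinearMap.mkContinuous
    { toFun := fun f => (memLp_integral_ratio hn h0 f).toLp
      map_add' := fun f g => by
        rw [← MemLp.toLp_add]
        refine MemLp.toLp_congr _ _ (Filter.Eventually.of_forall fun v => ?_)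
        change _ = (∫ x, min 1 (n v / n x) * f x ∂μ) + ∫ x, min 1 (n v / n x) * g x ∂μ
        rw [← integral_add (integrable_ratio_mul hn h0 (integrable_of_Lp_two f) v)
          (integrable_ratio_mul hn h0 (integrable_of_Lp_two g) v)]
        refine integral_congr_ae ?_
        filter_upwards [Lp.coeFn_add f g] with x hx
        rw [hx, Pi.add_apply, mul_add]
      map_smul' := fun c f => by
        rw [RingHom.id_apply, ← MemLp.toLp_const_smul]
        refine MemLp.toLp_congr _ _ (Filter.Eventually.of_forall fun v => ?_)
        change _ = c * ∫ x, min 1 (n v / n x) * f x ∂μ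
        rw [← integral_const_mul]
        refine integral_congr_ae ?_
        filter_upwards [Lp.coeFn_smul c f] with x hx
        rw [hx, Pi.smul_apply, smul_eq_mul]
        ring } 1 fun f => by
    have h := Lp.norm_le_of_ae_bound (f := (memLp_integral_ratio hn h0 f).toLp) (norm_nonneg f) (by
      filter_upwards [MemLp.coeFn_toLp (memLp_integral_ratio hn h0 f)] with v hv
      rw [hv]
      exact abs_integral_ratio_le hn h0 f v)
    simpa [measureUnivNNReal] using h

theorem coeFn_ratioOp (hn : Measurable n) (h0 : ∀ x, 0 ≤ n x) (f : Lp ℝ 2 μ) :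
    ratioOp hn h0 f =ᵐ[μ] fun v => ∫ x, min 1 (n v / n x) * f x ∂μ :=
  MemLp.coeFn_toLp (memLp_integral_ratio hn h0 f)

open scoped RealInnerProductSpace

theorem inner_ratioOp_self (hn : Measurable n) (h0 : ∀ x, 0 ≤ n x) (hpos : ∀ᵐ x ∂μ, 0 < n x)
    (f : Lp ℝ 2 μ) : (∫ x, f x ∂μ) ^ 2 / 2 ≤ ⟪ratioOp hn h0 f, f⟫ := by
  refine (half_sq_integral_le hn hpos (integrable_of_Lp_two f)).trans_eq ?_
  rw [L2.inner_def]
  refine integral_congr_ae ?_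
  filter_upwards [coeFn_ratioOp hn h0 f] with v hv
  rw [hv]
  simp [mul_comm]

theorem inner_const_one (f : Lp ℝ 2 μ) : ⟪Lp.const 2 μ (1 : ℝ), f⟫ = ∫ x, f x ∂μ := by
  rw [L2.inner_def]
  refine integral_congr_ae ?_
  filter_upwards [Lp.coeFn_const 2 μ (1 : ℝ)] with v hv
  rw [hv]
  simp

/-- The operator `f ↦ (∫ f) • 1` on `L²`. -/
noncomputable def meanOp : Lp ℝ 2 μ →L[ℝ] Lp ℝ 2 μ :=
  (innerSL ℝ (Lp.const 2 μ (1 : ℝ))).smulRight (Lp.const 2 μ (1 : ℝ))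

theorem meanOp_apply (f : Lp ℝ 2 μ) : meanOp f = (∫ x, f x ∂μ) • Lp.const 2 μ (1 : ℝ) := by
  simp [meanOp, inner_const_one]

variable {L : ℕ}

/-- The linear part of the map from queue choices to costs. -/
noncomputable def congestionOp (L : ℕ) (hn : Measurable n) (h0 : ∀ x, 0 ≤ n x) :
    PiLp 2 (fun _ : Fin L => Lp ℝ 2 μ) →L[ℝ] PiLp 2 (fun _ : Fin L => Lp ℝ 2 μ) :=
  (PiLp.continuousLinearEquiv 2 ℝ (fun _ : Fin L => Lp ℝ 2 μ)).symm.toContinuousLinearMap ∘L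
    ContinuousLinearMap.pi fun l =>
      (∑ j ∈ Finset.Ioi l, meanOp ∘L PiLp.proj 2 (fun _ : Fin L => Lp ℝ 2 μ) j)
        + ratioOp hn h0 ∘L PiLp.proj 2 (fun _ : Fin L => Lp ℝ 2 μ) l

theorem congestionOp_apply (hn : Measurable n) (h0 : ∀ x, 0 ≤ n x)
    (q : PiLp 2 (fun _ : Fin L => Lp ℝ 2 μ)) (l : Fin L) :
    congestionOp L hn h0 q l = (∑ j ∈ Finset.Ioi l, meanOp (q j)) + ratioOp hn h0 (q l) := by
  simp [congestionOp]

/-- Strict priority couples a queue only to higher ones; this triangular sum is half of the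
off-diagonal part of the full square. -/
theorem sum_Ioi_mul_sum (a : Fin L → ℝ) :
    ∑ l, a l * ∑ j ∈ Finset.Ioi l, a j = ((∑ l, a l) ^ 2 - ∑ l, a l ^ 2) / 2 := by
  have h1 : ∑ l, a l * ∑ j ∈ Finset.Ioi l, a j = ∑ l, a l * ∑ j ∈ Finset.Iio l, a j := by
    simp only [Finset.mul_sum]
    rw [Finset.sum_comm' (t' := Finset.univ) (s' := fun j => Finset.Iio j) (by simp)]
    exact Finset.sum_congr rfl fun _ _ => Finset.sum_congr rfl fun _ _ => mul_comm _ _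
  have h2 : (∑ l, a l) ^ 2 = ∑ l, a l * ∑ j ∈ Finset.Ioi l, a j
      + ∑ l, a l * ∑ j ∈ Finset.Iio l, a j + ∑ l, a l ^ 2 := by
    rw [sq, Finset.sum_mul, ← Finset.sum_add_distrib, ← Finset.sum_add_distrib]
    refine Finset.sum_congr rfl fun l _ => ?_
    rw [sq, ← mul_add, ← mul_add]
    congr 1
    have hu : (Finset.univ : Finset (Fin L)) = (Finset.Ioi l ∪ Finset.Iio l) ∪ {l} := by
      ext j
      simp only [Finset.mem_univ, Finset.mem_union, Finset.mem_Ioi, Finset.mem_Iio,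
        Finset.mem_singleton, true_iff]
      rcases lt_trichotomy j l with h | h | h <;> simp [h]
    rw [hu, Finset.sum_union, Finset.sum_union, Finset.sum_singleton]
    · exact Finset.disjoint_left.2 fun j h h' =>
        lt_asymm (Finset.mem_Ioi.1 h) (Finset.mem_Iio.1 h')
    · simp
  linarith

/-- The half squares gained within each queue exactly cancel the negative diagonal left by the
priority terms. What remains is half the square of the total mass. -/
theorem inner_congestionOp_self_nonneg (hn : Measurable n) (h0 : ∀ x, 0 ≤ n x)
    (hpos : ∀ᵐ x ∂μ, 0 < n x) (q : PiLp 2 (fun _ : Fin L => Lp ℝ 2 μ)) :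
    0 ≤ ⟪congestionOp L hn h0 q, q⟫ := by
  rw [PiLp.inner_apply]
  have h : ∀ l, (∫ x, q l x ∂μ) * (∑ j ∈ Finset.Ioi l, ∫ x, q j x ∂μ) + (∫ x, q l x ∂μ) ^ 2 / 2
      ≤ ⟪congestionOp L hn h0 q l, q l⟫ := by
    intro l
    rw [congestionOp_apply, inner_add_left, sum_inner]
    refine add_le_add (le_of_eq ?_) (inner_ratioOp_self hn h0 hpos _)
    rw [Finset.mul_sum]
    refine Finset.sum_congr rfl fun j _ => ?_
    rw [meanOp_apply, inner_smul_left, inner_const_one]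
    simp [mul_comm]
  refine le_trans ?_ (Finset.sum_le_sum fun l _ => h l)
  rw [Finset.sum_add_distrib, sum_Ioi_mul_sum, ← Finset.sum_div]
  have : 0 ≤ (∑ l, ∫ x, q l x ∂μ) ^ 2 := sq_nonneg _
  linarith

/-- The queue choices, as elements of `L²`. -/
def choiceSet (μ : Measure Ω) [IsProbabilityMeasure μ] (L : ℕ) :
    Set (PiLp 2 (fun _ : Fin L => Lp ℝ 2 μ)) :=
  {q | (∀ l, 0 ≤ q l) ∧ ∑ l, q l = Lp.const 2 μ (1 : ℝ)}

theorem isClosed_choiceSet : IsClosed (choiceSet μ L) := by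
  refine IsClosed.inter ?_ ?_
  · change IsClosed {q : PiLp 2 (fun _ : Fin L => Lp ℝ 2 μ) | ∀ l, 0 ≤ q l}
    rw [ofPred_forall]
    exact isClosed_iInter fun l => isClosed_le continuous_const (PiLp.continuous_apply 2 _ l)
  · exact isClosed_eq (continuous_finsetSum _ fun l _ => PiLp.continuous_apply 2 _ l)
      continuous_const

theorem convex_choiceSet : Convex ℝ (choiceSet μ L) := by
  intro q hq r hr a b ha hb hab
  refine ⟨fun l => ?_, ?_⟩
  · rw [PiLp.add_apply, PiLp.smul_apply, PiLp.smul_apply]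
    exact add_nonneg (Lp_smul_nonneg ha (hq.1 l)) (Lp_smul_nonneg hb (hr.1 l))
  · simp only [PiLp.add_apply, PiLp.smul_apply, Finset.sum_add_distrib, ← Finset.smul_sum]
    rw [hq.2, hr.2, ← add_smul, hab, one_smul]

theorem isBounded_choiceSet : Bornology.IsBounded (choiceSet μ L) := by
  rw [isBounded_iff_forall_norm_le]
  refine ⟨√(∑ _l : Fin L, ‖Lp.const 2 μ (1 : ℝ)‖ ^ 2), fun q hq => ?_⟩
  rw [PiLp.norm_eq_of_L2]
  refine Real.sqrt_le_sqrt (Finset.sum_le_sum fun l _ => ?_)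
  gcongr
  refine norm_le_norm_of_abs_le_abs ?_
  have h1 : q l ≤ Lp.const 2 μ (1 : ℝ) := by
    rw [← hq.2]
    exact Finset.single_le_sum (fun j _ => hq.1 j) (Finset.mem_univ l)
  rw [abs_of_nonneg (hq.1 l), abs_of_nonneg ((hq.1 l).trans h1)]
  exact h1

end RatioOperator

/-! ### Best replies for almost every type -/

section BestReply

variable {L : ℕ}

open Classical in
/-- The unit vector of the first index at which `c` is minimal. -/
noncomputable def leastArgmin (c : Fin L → ℝ) (l : Fin L) : ℝ :=
  if (∀ j < l, c l < c j) ∧ ∀ j, c l ≤ c j then 1 else 0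

theorem lt_of_leastArgmin_ne_zero {c : Fin L → ℝ} {l : Fin L} (h : leastArgmin c l ≠ 0) :
    (∀ j < l, c l < c j) ∧ ∀ j, c l ≤ c j := by
  by_contra hc
  exact h (if_neg hc)

theorem exists_leastArgmin_eq_single [NeZero L] (c : Fin L → ℝ) :
    ∃ l, (∀ j, c l ≤ c j) ∧ leastArgmin c = Pi.single l 1 := by
  classical
  have hne : (Finset.univ.filter fun l => ∀ j, c l ≤ c j).Nonempty := by
    obtain ⟨l, -, hl⟩ := Finset.exists_min_image Finset.univ c ⟨0, Finset.mem_univ _⟩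
    exact ⟨l, by simpa using hl⟩
  set l := (Finset.univ.filter fun l => ∀ j, c l ≤ c j).min' hne
  have hl : ∀ j, c l ≤ c j := (Finset.mem_filter.1 (Finset.min'_mem _ hne)).2
  have hlt : ∀ j < l, c l < c j := by
    intro j hj
    by_contra! hc
    refine hj.not_ge (Finset.min'_le _ _ ?_)
    simp only [Finset.mem_filter, Finset.mem_univ, true_and]
    exact fun i => hc.trans (hl i)
  refine ⟨l, hl, funext fun k => ?_⟩
  rcases eq_or_ne k l with rfl | hk
  · rw [Pi.single_eq_same]
    exact if_pos ⟨hlt, hl⟩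
  · rw [Pi.single_eq_of_ne hk]
    refine if_neg fun h => ?_
    rcases lt_or_gt_of_ne hk with h' | h'
    · exact (hlt k h').not_ge (h.2 l)
    · exact (h.1 l h').not_ge (hl k)

theorem leastArgmin_mem_stdSimplex [NeZero L] (c : Fin L → ℝ) :
    leastArgmin c ∈ stdSimplex ℝ (Fin L) := by
  obtain ⟨l, -, h⟩ := exists_leastArgmin_eq_single c
  rw [h]
  exact single_mem_stdSimplex ℝ l

theorem stdSimplex_sum_mul_ge {c r : Fin L → ℝ} (hr : r ∈ stdSimplex ℝ (Fin L)) {a : ℝ}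
    (ha : ∀ j, a ≤ c j) : a ≤ ∑ l, r l * c l := by
  calc a = ∑ l, r l * a := by rw [← Finset.sum_mul, hr.2, one_mul]
    _ ≤ _ := Finset.sum_le_sum fun l _ => mul_le_mul_of_nonneg_left (ha l) (hr.1 l)

/-- A probability vector minimizes `∑ r l * c l` only if it is carried by the minima of `c`. -/
theorem le_of_ne_zero_of_sum_le {c r : Fin L → ℝ} (hr : r ∈ stdSimplex ℝ (Fin L)) {k : Fin L}
    (hk : ∀ j, c k ≤ c j) (h : ∑ l, r l * c l ≤ c k) {l : Fin L} (hl : r l ≠ 0) :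
    ∀ j, c l ≤ c j := by
  intro j
  refine le_trans ?_ (hk j)
  by_contra! hc
  have hlt : ∑ l, r l * c k < ∑ l, r l * c l := by
    refine Finset.sum_lt_sum (fun i _ => mul_le_mul_of_nonneg_left (hk i) (hr.1 i))
      ⟨l, Finset.mem_univ _, ?_⟩
    exact mul_lt_mul_of_pos_left hc (lt_of_le_of_ne (hr.1 l) hl.symm)
  rw [← Finset.sum_mul, hr.2, one_mul] at hlt
  exact hlt.not_ge h

theorem stdSimplex_eq_one {r : Fin L → ℝ} (hr : r ∈ stdSimplex ℝ (Fin L)) {l : Fin L}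
    (h : ∀ j, j ≠ l → r j = 0) : r l = 1 := by
  rw [← hr.2, Finset.sum_eq_single l (fun j _ hj => h j hj) (by simp)]

/-- Without ties there is only one minimizer, so only one optimal randomization. -/
theorem eq_leastArgmin_of_ne [NeZero L] {c r : Fin L → ℝ} (hr : r ∈ stdSimplex ℝ (Fin L))
    (hc : ∀ k l, k < l → c k ≠ c l) (h : ∀ l, r l ≠ 0 → ∀ j, c l ≤ c j) : r = leastArgmin c := by
  obtain ⟨k, hk, hk'⟩ := exists_leastArgmin_eq_single c
  have h0 : ∀ l, l ≠ k → r l = 0 := by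
    intro l hl
    by_contra hne
    have e : c l = c k := le_antisymm (h l hne k) (hk l)
    rcases lt_or_gt_of_ne hl with hlt | hlt
    · exact hc _ _ hlt e
    · exact hc _ _ hlt e.symm
  have h1 : r k = 1 := stdSimplex_eq_one hr h0
  rw [hk']
  funext l
  rcases eq_or_ne l k with rfl | hl
  · rw [h1, Pi.single_eq_same]
  · rw [h0 l hl, Pi.single_eq_of_ne hl]

theorem sum_leastArgmin_mul [NeZero L] (c : Fin L → ℝ) {l : Fin L}
    (h : leastArgmin c = Pi.single l 1) : ∑ j, leastArgmin c j * c j = c l := by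
  rw [h, Finset.sum_eq_single l]
  · simp
  · intro j _ hj
    simp [Pi.single_eq_of_ne hj]
  · simp

variable {Ω : Type*} [MeasurableSpace Ω]

theorem measurable_leastArgmin {c : Fin L → Ω → ℝ} (hc : ∀ l, Measurable (c l)) (l : Fin L) :
    Measurable fun x => leastArgmin (fun j => c j x) l := by
  refine Measurable.ite ?_ measurable_const measurable_const
  refine MeasurableSet.inter ?_ ?_
  · change MeasurableSet {x | ∀ j < l, c l x < c j x}
    simp only [ofPred_forall]
    exact MeasurableSet.iInter fun j => MeasurableSet.iInter fun _ =>
      measurableSet_lt (hc l) (hc j)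
  · change MeasurableSet {x | ∀ j, c l x ≤ c j x}
    simp only [ofPred_forall]
    exact MeasurableSet.iInter fun j => measurableSet_le (hc l) (hc j)

/-- The cost of queue `l` for type `v`, once arrival times are chosen optimally, as a function of
the queue choices `q`. -/
noncomputable def congestionCost (μ : Measure Ω) (n m : Ω → ℝ) (P : Fin L → ℝ) (N : ℝ)
    (q : Fin L → Ω → ℝ) (l : Fin L) (v : Ω) : ℝ :=
  m v * P l + N * ∑ j ∈ Finset.Ioi l, ∫ x, q j x ∂μ + N * ∫ x, min 1 (n v / n x) * q l x ∂μ

theorem measurable_congestionCost {μ : Measure Ω} [SFinite μ] {n m : Ω → ℝ} (hn : Measurable n)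
    (hm : Measurable m) (P : Fin L → ℝ) (N : ℝ) {q : Fin L → Ω → ℝ} (hq : ∀ l, Measurable (q l))
    (l : Fin L) : Measurable (congestionCost μ n m P N q l) := by
  have h : Measurable fun v => ∫ x, min 1 (n v / n x) * q l x ∂μ := by
    refine (StronglyMeasurable.integral_prod_right ?_).measurable
    refine Measurable.stronglyMeasurable ?_
    have := hq l
    change Measurable fun p : Ω × Ω => min 1 (n p.1 / n p.2) * q l p.2
    fun_prop
  unfold congestionCost
  fun_prop

open scoped RealInnerProductSpace

/-- There are queue choices that are a best reply to themselves, for almost every type. -/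
theorem exists_ae_bestReply [NeZero L] {μ : Measure Ω} [IsProbabilityMeasure μ] {n m : Ω → ℝ}
    (hn : Measurable n) (h0 : ∀ x, 0 ≤ n x) (hpos : ∀ᵐ x ∂μ, 0 < n x) (hm : Measurable m) {C : ℝ}
    (hC : ∀ x, |m x| ≤ C) (P : Fin L → ℝ) {N : ℝ} (hN : 0 ≤ N) :
    ∃ q : Fin L → Ω → ℝ, (∀ l, Measurable (q l)) ∧ ∀ᵐ x ∂μ,
      (fun l => q l x) ∈ stdSimplex ℝ (Fin L) ∧ ∀ l, q l x ≠ 0 →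
        ∀ j, congestionCost μ n m P N q l x ≤ congestionCost μ n m P N q j x := by
  have hmL : MemLp m 2 μ :=
    MemLp.of_bound hm.aestronglyMeasurable C (Filter.Eventually.of_forall hC)
  have memr : ∀ r : Fin L → Ω → ℝ, (∀ l, Measurable (r l)) →
      (∀ x, (fun l => r l x) ∈ stdSimplex ℝ (Fin L)) → ∀ l, MemLp (r l) 2 μ := by
    intro r hr hs l
    refine MemLp.of_bound (hr l).aestronglyMeasurable 1 (Filter.Eventually.of_forall fun x => ?_)
    rw [Real.norm_of_nonneg ((hs x).1 l), ← (hs x).2]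
    exact Finset.single_le_sum (fun j _ => (hs x).1 j) (Finset.mem_univ l)
  have memK : ∀ (r : Fin L → Ω → ℝ) (hr : ∀ l, Measurable (r l))
      (hs : ∀ x, (fun l => r l x) ∈ stdSimplex ℝ (Fin L)),
      WithLp.toLp 2 (fun l => (memr r hr hs l).toLp (r l)) ∈ choiceSet μ L := by
    intro r hr hs
    refine ⟨fun l => ?_, ?_⟩
    · rw [← Lp.coeFn_nonneg]
      filter_upwards [MemLp.coeFn_toLp (memr r hr hs l)] with x hx
      simp only [Pi.zero_apply]
      rw [hx]
      exact (hs x).1 l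
    · refine Lp.ext ?_
      have h1 : ∀ᵐ x ∂μ, ∀ l, (memr r hr hs l).toLp (r l) x = r l x :=
        ae_all_iff.2 fun l => MemLp.coeFn_toLp (memr r hr hs l)
      filter_upwards [h1, Lp.coeFn_const 2 μ (1 : ℝ),
        Lp.coeFn_finsetSum (Finset.univ : Finset (Fin L))
          fun l => (memr r hr hs l).toLp (r l)] with x hx hx1 hx2
      rw [hx1]
      refine hx2.trans ?_
      rw [Finset.sum_apply]
      simp only [hx]
      exact (hs x).2
  obtain ⟨Q, hQ, hvi⟩ := exists_variational_of_monotone (N • congestionOp L hn h0)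
    (WithLp.toLp 2 fun l => P l • hmL.toLp m) (K := choiceSet μ L)
    ⟨_, memK (fun l _ => leastArgmin (0 : Fin L → ℝ) l) (fun _ => measurable_const)
      fun _ => leastArgmin_mem_stdSimplex 0⟩
    isClosed_choiceSet convex_choiceSet isBounded_choiceSet (fun q => by
      rw [smul_apply, inner_smul_left]
      exact mul_nonneg hN (inner_congestionOp_self_nonneg hn h0 hpos q))
  have hQm : ∀ l, Measurable (Q l) := fun l => (Lp.stronglyMeasurable (Q l)).measurable
  have hQs : ∀ᵐ x ∂μ, (fun l => Q l x) ∈ stdSimplex ℝ (Fin L) := by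
    have h1 : ∀ᵐ x ∂μ, ∀ l, 0 ≤ Q l x :=
      ae_all_iff.2 fun l => (Lp.coeFn_nonneg (Q l)).2 (hQ.1 l)
    filter_upwards [h1, Lp.coeFn_const 2 μ (1 : ℝ),
      Lp.coeFn_finsetSum (Finset.univ : Finset (Fin L)) fun l => Q l] with x hx hx1 hx2
    refine ⟨hx, ?_⟩
    rw [hQ.2, hx1, Finset.sum_apply] at hx2
    exact hx2.symm
  set c := congestionCost μ n m P N (fun l => Q l) with hc
  have hcm : ∀ l, Measurable (c l) := measurable_congestionCost hn hm P N hQm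
  have hcost : ∀ l, ((N • congestionOp L hn h0) Q + WithLp.toLp 2 fun l => P l • hmL.toLp m) l
      =ᵐ[μ] c l := by
    intro l
    rw [PiLp.add_apply, smul_apply, PiLp.smul_apply, congestionOp_apply]
    simp only [meanOp_apply]
    rw [← Finset.sum_smul]
    filter_upwards [coeFn_ratioOp hn h0 (Q l), hmL.coeFn_toLp, Lp.coeFn_const 2 μ (1 : ℝ),
      Lp.coeFn_add (N • ((∑ j ∈ Finset.Ioi l, ∫ x, Q j x ∂μ) • Lp.const 2 μ (1 : ℝ)
        + ratioOp hn h0 (Q l))) (P l • hmL.toLp m),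
      Lp.coeFn_smul N ((∑ j ∈ Finset.Ioi l, ∫ x, Q j x ∂μ) • Lp.const 2 μ (1 : ℝ)
        + ratioOp hn h0 (Q l)),
      Lp.coeFn_add ((∑ j ∈ Finset.Ioi l, ∫ x, Q j x ∂μ) • Lp.const 2 μ (1 : ℝ))
        (ratioOp hn h0 (Q l)),
      Lp.coeFn_smul (∑ j ∈ Finset.Ioi l, ∫ x, Q j x ∂μ) (Lp.const 2 μ (1 : ℝ)),
      Lp.coeFn_smul (P l) (hmL.toLp m)] with x e1 e2 e3 e4 e5 e6 e7 e8
    rw [e4, Pi.add_apply, e5, Pi.smul_apply, e6, Pi.add_apply, e7, Pi.smul_apply, e8,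
      Pi.smul_apply, e1, e2, e3, hc, congestionCost]
    simp only [smul_eq_mul, Function.const_apply]
    ring
  refine ⟨fun l => Q l, hQm, ?_⟩
  -- Test the variational inequality with the pointwise best reply `r` to the costs of `Q`. The
  -- integrand `∑ l, (r l * c l - Q l * c l)` is nonpositive but has nonnegative integral, so it
  -- vanishes almost everywhere.
  set r : Fin L → Ω → ℝ := fun l x => leastArgmin (fun j => c j x) l with hr
  have hrm : ∀ l, Measurable (r l) := measurable_leastArgmin hcm
  have hrs : ∀ x, (fun l => r l x) ∈ stdSimplex ℝ (Fin L) := fun x =>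
    leastArgmin_mem_stdSimplex _
  have h := hvi _ (memK r hrm hrs)
  rw [PiLp.inner_apply] at h
  have hint : ∀ l, Integrable (fun x => r l x * c l x - Q l x * c l x) μ ∧
      ⟪((N • congestionOp L hn h0) Q + WithLp.toLp 2 fun l => P l • hmL.toLp m) l,
        (WithLp.toLp 2 (fun l => (memr r hrm hrs l).toLp (r l)) - Q) l⟫
      = ∫ x, (r l x * c l x - Q l x * c l x) ∂μ := by
    intro l
    have hae : (fun x => ⟪((N • congestionOp L hn h0) Q
        + WithLp.toLp 2 fun l => P l • hmL.toLp m) l x,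
        (WithLp.toLp 2 (fun l => (memr r hrm hrs l).toLp (r l)) - Q) l x⟫) =ᵐ[μ]
        fun x => r l x * c l x - Q l x * c l x := by
      filter_upwards [hcost l, MemLp.coeFn_toLp (memr r hrm hrs l),
        Lp.coeFn_sub ((memr r hrm hrs l).toLp (r l)) (Q l)] with x e1 e2 e3
      rw [e1, PiLp.sub_apply, e3, Pi.sub_apply, e2]
      simp only [RCLike.inner_apply, conj_trivial]
      ring
    refine ⟨(L2.integrable_inner _ _).congr hae, ?_⟩
    rw [L2.inner_def]
    exact integral_congr_ae hae
  rw [Finset.sum_congr rfl fun l _ => (hint l).2, ← integral_finsetSum _ fun l _ => (hint l).1] at h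
  have hnonneg : 0 ≤ᵐ[μ] fun x => -∑ l, (r l x * c l x - Q l x * c l x) := by
    filter_upwards [hQs] with x hx
    obtain ⟨k, hk, hk'⟩ := exists_leastArgmin_eq_single fun j => c j x
    have h1 := stdSimplex_sum_mul_ge hx hk
    have h2 := sum_leastArgmin_mul (fun j => c j x) hk'
    simp only [Pi.zero_apply, Finset.sum_sub_distrib, hr]
    linarith
  have hzero := (integral_eq_zero_iff_of_nonneg_ae hnonneg
    (integrable_finsetSum _ fun l _ => (hint l).1).neg).1 (by
      refine le_antisymm ?_ (integral_nonneg_of_ae hnonneg)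
      rw [integral_neg]
      linarith)
  filter_upwards [hQs, hzero] with x hx hx0
  refine ⟨hx, fun l hl => ?_⟩
  obtain ⟨k, hk, hk'⟩ := exists_leastArgmin_eq_single fun j => c j x
  refine le_of_ne_zero_of_sum_le (c := fun j => c j x) hx hk ?_ hl
  have h2 := sum_leastArgmin_mul (fun j => c j x) hk'
  simp only [Pi.zero_apply, Finset.sum_sub_distrib, hr] at hx0
  linarith

end BestReply

namespace BoardingGame

/-! ### The load of a queue as a function of the type -/

section Load

variable {L : ℕ} [NeZero L] (G : BoardingGame L)

instance isProbabilityMeasure_μ : IsProbabilityMeasure G.μ := G.isProb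

instance nullSingletonClass_μ : NullSingletonClass G.μ := ⟨G.null_singleton⟩

theorem ae_mem_Icc : ∀ᵐ x ∂G.μ, x ∈ Icc G.A G.B := G.carried

/-- The left end is removed because `n` may vanish there; it is null since there are no atoms. -/
theorem ae_mem_Ioc : ∀ᵐ x ∂G.μ, x ∈ Ioc G.A G.B := by
  have h : ∀ᵐ x ∂G.μ, x ≠ G.A := by
    rw [ae_iff]
    simp
  filter_upwards [G.ae_mem_Icc, h] with x hx hxA
  exact ⟨lt_of_le_of_ne hx.1 hxA.symm, hx.2⟩

theorem restrict_Icc : G.μ.restrict (Icc G.A G.B) = G.μ :=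
  Measure.restrict_eq_self_of_ae_mem G.ae_mem_Icc

theorem left_mem : G.A ∈ Icc G.A G.B := left_mem_Icc.2 G.A_lt_B.le

theorem right_mem : G.B ∈ Icc G.A G.B := right_mem_Icc.2 G.A_lt_B.le

theorem n_nonneg' {x : ℝ} (hx : x ∈ Icc G.A G.B) : 0 ≤ G.n x :=
  G.n_nonneg.trans (G.n_strictMono.monotoneOn G.left_mem hx hx.1)

theorem n_pos {x : ℝ} (hx : x ∈ Ioc G.A G.B) : 0 < G.n x :=
  G.n_nonneg.trans_lt (G.n_strictMono G.left_mem (Ioc_subset_Icc_self hx) hx.1)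

theorem aemeasurable_n : AEMeasurable G.n G.μ := by
  rw [← G.restrict_Icc]
  exact G.n_cont.aemeasurable measurableSet_Icc

variable {G}

theorem A1.integrable_inv (h1 : G.A1) : Integrable (fun x => 1 / G.n x) G.μ := by
  have h := h1.2
  rwa [IntegrableOn, G.restrict_Icc] at h

variable (G)

/-- A measurable choice of a probability for each type. -/
structure IsShare (f : ℝ → ℝ) : Prop where
  aemeasurable : AEMeasurable f G.μ
  nonneg : ∀ x ∈ Icc G.A G.B, 0 ≤ f x
  le_one : ∀ x ∈ Icc G.A G.B, f x ≤ 1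

/-- The mass of the types up to `v`, weighted by `f`. -/
noncomputable def cum (f : ℝ → ℝ) (v : ℝ) : ℝ :=
  ∫ x in Iic v, f x ∂G.μ

/-- The integral of `f / n` over the types above `v`. -/
noncomputable def tail (f : ℝ → ℝ) (v : ℝ) : ℝ :=
  ∫ x in Ioi v, f x * (1 / G.n x) ∂G.μ

/-- The equilibrium cost of type `v` in a queue joined with probability `f`, up to the price and
the number of customers. -/
noncomputable def load (f : ℝ → ℝ) (v : ℝ) : ℝ :=
  ∫ x, min 1 (G.n v / G.n x) * f x ∂G.μ

variable {G} {f : ℝ → ℝ}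

theorem isShare_one : G.IsShare fun _ => 1 :=
  ⟨aemeasurable_const, fun _ _ => zero_le_one, fun _ _ => le_rfl⟩

namespace IsShare

theorem compl (hf : G.IsShare f) : G.IsShare fun x => 1 - f x :=
  ⟨hf.aemeasurable.const_sub 1, fun x hx => sub_nonneg.2 (hf.le_one x hx),
    fun x hx => sub_le_self _ (hf.nonneg x hx)⟩

theorem ae_nonneg (hf : G.IsShare f) : ∀ᵐ x ∂G.μ, 0 ≤ f x := by
  filter_upwards [G.ae_mem_Icc] with x hx using hf.nonneg x hx

theorem ae_norm_le (hf : G.IsShare f) : ∀ᵐ x ∂G.μ, ‖f x‖ ≤ 1 := by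
  filter_upwards [G.ae_mem_Icc] with x hx
  rw [Real.norm_of_nonneg (hf.nonneg x hx)]
  exact hf.le_one x hx

theorem integrable (hf : G.IsShare f) : Integrable f G.μ :=
  Integrable.of_bound hf.aemeasurable.aestronglyMeasurable 1 hf.ae_norm_le

theorem integral_nonneg (hf : G.IsShare f) : 0 ≤ ∫ x, f x ∂G.μ :=
  integral_nonneg_of_ae hf.ae_nonneg

theorem integral_le_one (hf : G.IsShare f) : ∫ x, f x ∂G.μ ≤ 1 := by
  have h : ∫ x, f x ∂G.μ ≤ ∫ _, (1 : ℝ) ∂G.μ := by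
    refine integral_mono_ae hf.integrable (integrable_const _) ?_
    filter_upwards [G.ae_mem_Icc] with x hx using hf.le_one x hx
  simpa using h

theorem integrable_div (hf : G.IsShare f) (h1 : G.A1) :
    Integrable (fun x => f x * (1 / G.n x)) G.μ :=
  h1.integrable_inv.bdd_mul hf.aemeasurable.aestronglyMeasurable hf.ae_norm_le

theorem ae_div_nonneg (hf : G.IsShare f) : ∀ᵐ x ∂G.μ, 0 ≤ f x * (1 / G.n x) := by
  filter_upwards [G.ae_mem_Icc] with x hx
  exact mul_nonneg (hf.nonneg x hx) (one_div_nonneg.2 (G.n_nonneg' hx))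

theorem integrable_ratio (hf : G.IsShare f) {v : ℝ} (hv : v ∈ Icc G.A G.B) :
    Integrable (fun x => min 1 (G.n v / G.n x) * f x) G.μ := by
  have := G.aemeasurable_n
  refine hf.integrable.bdd_mul (c := 1) (AEMeasurable.aestronglyMeasurable ?_) ?_
  · exact aemeasurable_const.min (aemeasurable_const.div this)
  · filter_upwards [G.ae_mem_Icc] with x hx
    exact abs_min_one_div_le (div_nonneg (G.n_nonneg' hv) (G.n_nonneg' hx))

theorem cum_sub (hf : G.IsShare f) {v w : ℝ} (hvw : v ≤ w) :
    G.cum f w - G.cum f v = ∫ x in Ioc v w, f x ∂G.μ := by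
  rw [cum, cum, intervalIntegral.integral_Iic_sub_Iic hf.integrable.integrableOn
    hf.integrable.integrableOn, intervalIntegral.integral_of_le hvw]

theorem cum_mono (hf : G.IsShare f) : Monotone (G.cum f) := fun v w hvw => by
  rw [← sub_nonneg, hf.cum_sub hvw]
  exact integral_nonneg_of_ae (ae_restrict_of_ae hf.ae_nonneg)

theorem tail_eq (hf : G.IsShare f) (h1 : G.A1) (v : ℝ) :
    G.tail f v = ∫ x, f x * (1 / G.n x) ∂G.μ - ∫ x in Iic v, f x * (1 / G.n x) ∂G.μ := by
  rw [tail, ← integral_add_compl measurableSet_Iic (hf.integrable_div h1), compl_Iic]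
  ring

theorem tail_sub (hf : G.IsShare f) (h1 : G.A1) {v w : ℝ} (hvw : v ≤ w) :
    G.tail f v - G.tail f w = ∫ x in Ioc v w, f x * (1 / G.n x) ∂G.μ := by
  have h := hf.integrable_div h1
  rw [hf.tail_eq h1, hf.tail_eq h1, sub_sub_sub_cancel_left,
    intervalIntegral.integral_Iic_sub_Iic h.integrableOn h.integrableOn,
    intervalIntegral.integral_of_le hvw]

theorem tail_nonneg (hf : G.IsShare f) (v : ℝ) : 0 ≤ G.tail f v :=
  integral_nonneg_of_ae (ae_restrict_of_ae hf.ae_div_nonneg)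

theorem tail_anti (hf : G.IsShare f) (h1 : G.A1) : Antitone (G.tail f) := fun v w hvw => by
  rw [← sub_nonneg, hf.tail_sub h1 hvw]
  exact integral_nonneg_of_ae (ae_restrict_of_ae hf.ae_div_nonneg)

theorem tail_right : G.tail f G.B = 0 := by
  refine setIntegral_measure_zero _ (measure_mono_null ?_ G.carried)
  exact fun x hx hx' => hx.not_ge hx'.2

theorem cum_left : G.cum f G.A = 0 := by
  refine setIntegral_measure_zero _ ?_
  have h := G.ae_mem_Ioc
  rw [ae_iff] at h
  refine measure_mono_null (fun x hx => ?_) h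
  exact fun h' => h'.1.not_ge hx

theorem cum_right : G.cum f G.B = ∫ x, f x ∂G.μ := by
  rw [cum, Measure.restrict_eq_self_of_ae_mem]
  filter_upwards [G.ae_mem_Icc] with x hx using hx.2

theorem tail_continuous (hf : G.IsShare f) (h1 : G.A1) : Continuous (G.tail f) := by
  have h := hf.integrable_div h1
  have e : G.tail f = fun v => G.tail f 0 - ∫ x in (0 : ℝ)..v, f x * (1 / G.n x) ∂G.μ := by
    funext v
    rw [hf.tail_eq h1, hf.tail_eq h1, ← intervalIntegral.integral_Iic_sub_Iic h.integrableOn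
      h.integrableOn]
    ring
  rw [e]
  exact continuous_const.sub
    (intervalIntegral.continuous_primitive (fun _ _ => h.intervalIntegrable) 0)

/-- The mass between two types is comparable to the `1 / n`-weighted mass. -/
theorem cum_sub_bounds (hf : G.IsShare f) (h1 : G.A1) {v w : ℝ} (hv : v ∈ Icc G.A G.B)
    (hw : w ∈ Icc G.A G.B) (hvw : v ≤ w) :
    G.n v * (G.tail f v - G.tail f w) ≤ G.cum f w - G.cum f v ∧
      G.cum f w - G.cum f v ≤ G.n w * (G.tail f v - G.tail f w) := by
  rw [hf.cum_sub hvw, hf.tail_sub h1 hvw, ← integral_const_mul, ← integral_const_mul]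
  have hi := ((hf.integrable_div h1).const_mul (G.n v)).restrict (s := Ioc v w)
  have hi' := ((hf.integrable_div h1).const_mul (G.n w)).restrict (s := Ioc v w)
  have hae : ∀ᵐ x ∂G.μ.restrict (Ioc v w), x ∈ Ioc v w ∧ x ∈ Ioc G.A G.B :=
    (ae_restrict_mem measurableSet_Ioc).and (ae_restrict_of_ae G.ae_mem_Ioc)
  constructor
  · refine integral_mono_ae hi hf.integrable.restrict ?_
    filter_upwards [hae] with x hx
    have hn := G.n_pos hx.2
    have h2 : G.n v / G.n x ≤ 1 := by
      rw [div_le_one hn]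
      exact G.n_strictMono.monotoneOn hv (Ioc_subset_Icc_self hx.2) hx.1.1.le
    calc G.n v * (f x * (1 / G.n x)) = G.n v / G.n x * f x := by ring
      _ ≤ f x := mul_le_of_le_one_left (hf.nonneg x (Ioc_subset_Icc_self hx.2)) h2
  · refine integral_mono_ae hf.integrable.restrict hi' ?_
    filter_upwards [hae] with x hx
    have hn := G.n_pos hx.2
    have h2 : 1 ≤ G.n w / G.n x := by
      rw [one_le_div hn]
      exact G.n_strictMono.monotoneOn (Ioc_subset_Icc_self hx.2) hw hx.1.2
    calc f x ≤ G.n w / G.n x * f x :=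
          le_mul_of_one_le_left (hf.nonneg x (Ioc_subset_Icc_self hx.2)) h2
      _ = G.n w * (f x * (1 / G.n x)) := by ring

/-- Since `n` increases, the kernel is `1` for types up to `v` and `n v / n x` above. -/
theorem load_eq (hf : G.IsShare f) {v : ℝ} (hv : v ∈ Icc G.A G.B) :
    G.load f v = G.cum f v + G.n v * G.tail f v := by
  rw [load, ← integral_add_compl (measurableSet_Iic (a := v)) (hf.integrable_ratio hv), compl_Iic,
    cum, tail, ← integral_const_mul]
  congr 1
  · refine integral_congr_ae ?_
    filter_upwards [ae_restrict_mem measurableSet_Iic, ae_restrict_of_ae G.ae_mem_Ioc] with x hx hx'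
    rw [min_eq_left, one_mul]
    rw [one_le_div (G.n_pos hx')]
    exact G.n_strictMono.monotoneOn (Ioc_subset_Icc_self hx') hv hx
  · refine integral_congr_ae ?_
    filter_upwards [ae_restrict_mem measurableSet_Ioi, ae_restrict_of_ae G.ae_mem_Ioc] with x hx hx'
    rw [min_eq_right]
    · ring
    · rw [div_le_one (G.n_pos hx')]
      exact G.n_strictMono.monotoneOn hv (Ioc_subset_Icc_self hx') (le_of_lt hx)

theorem load_nonneg (hf : G.IsShare f) {v : ℝ} (hv : v ∈ Icc G.A G.B) : 0 ≤ G.load f v := by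
  refine integral_nonneg_of_ae ?_
  filter_upwards [G.ae_mem_Icc] with x hx
  exact mul_nonneg (le_min zero_le_one (div_nonneg (G.n_nonneg' hv) (G.n_nonneg' hx)))
    (hf.nonneg x hx)

theorem load_le (hf : G.IsShare f) {v : ℝ} (hv : v ∈ Icc G.A G.B) :
    G.load f v ≤ ∫ x, f x ∂G.μ := by
  refine integral_mono_ae (hf.integrable_ratio hv) hf.integrable ?_
  filter_upwards [G.ae_mem_Icc] with x hx
  exact mul_le_of_le_one_left (hf.nonneg x hx) (min_le_left _ _)

theorem load_right (hf : G.IsShare f) : G.load f G.B = ∫ x, f x ∂G.μ := by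
  rw [hf.load_eq G.right_mem, tail_right, cum_right, mul_zero, add_zero]

/-- The increments of `load` lie between the increments of `n` times the end values of `tail`. -/
theorem load_sub_bounds (hf : G.IsShare f) (h1 : G.A1) {v w : ℝ} (hv : v ∈ Icc G.A G.B)
    (hw : w ∈ Icc G.A G.B) (hvw : v ≤ w) :
    (G.n w - G.n v) * G.tail f w ≤ G.load f w - G.load f v ∧
      G.load f w - G.load f v ≤ (G.n w - G.n v) * G.tail f v := by
  obtain ⟨h2, h3⟩ := hf.cum_sub_bounds h1 hv hw hvw
  rw [hf.load_eq hv, hf.load_eq hw]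
  constructor <;> linarith

theorem load_monotoneOn (hf : G.IsShare f) (h1 : G.A1) :
    MonotoneOn (G.load f) (Icc G.A G.B) := fun v hv w hw hvw => by
  have h := (hf.load_sub_bounds h1 hv hw hvw).1
  have h2 : 0 ≤ (G.n w - G.n v) * G.tail f w :=
    mul_nonneg (sub_nonneg.2 (G.n_strictMono.monotoneOn hv hw hvw)) (hf.tail_nonneg w)
  linarith

theorem load_add_compl (hf : G.IsShare f) {v : ℝ} (hv : v ∈ Icc G.A G.B) :
    G.load f v + G.load (fun x => 1 - f x) v = G.load (fun _ => 1) v := by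
  rw [load, load, load, ← integral_add (hf.integrable_ratio hv) (hf.compl.integrable_ratio hv)]
  congr 1
  funext x
  ring

/-- The complementary share has a monotone load, and the two loads add up to that of the whole
population. Hence a bound for the whole population, as in (A2), serves every queue. -/
theorem load_sub_le (hf : G.IsShare f) (h1 : G.A1) {v w : ℝ} (hv : v ∈ Icc G.A G.B)
    (hw : w ∈ Icc G.A G.B) (hvw : v ≤ w) :
    G.load f w - G.load f v ≤ G.load (fun _ => 1) w - G.load (fun _ => 1) v := by
  rw [← hf.load_add_compl hv, ← hf.load_add_compl hw]
  linarith [hf.compl.load_monotoneOn h1 hv hw hvw]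

theorem abs_load_sub_le (hf : G.IsShare f) (h1 : G.A1) {v w : ℝ} (hv : v ∈ Icc G.A G.B)
    (hw : w ∈ Icc G.A G.B) :
    |G.load f w - G.load f v - (G.n w - G.n v) * G.tail f v|
      ≤ |(G.n w - G.n v) * (G.tail f w - G.tail f v)| := by
  rcases le_total v w with h | h
  · obtain ⟨h2, h3⟩ := hf.load_sub_bounds h1 hv hw h
    rw [abs_of_nonpos (by linarith), abs_of_nonpos (by linarith)]
    linarith
  · obtain ⟨h2, h3⟩ := hf.load_sub_bounds h1 hw hv h
    rw [abs_of_nonpos (by linarith), abs_of_nonpos (by linarith)]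
    linarith

theorem load_continuousOn (hf : G.IsShare f) (h1 : G.A1) :
    ContinuousOn (G.load f) (Icc G.A G.B) := by
  have e : EqOn (G.load f) (fun v => G.cum f v + G.n v * G.tail f v) (Icc G.A G.B) :=
    fun v hv => hf.load_eq hv
  refine ContinuousOn.congr ?_ e
  refine ContinuousOn.add (Continuous.continuousOn ?_)
    (G.n_cont.mul (hf.tail_continuous h1).continuousOn)
  have e2 : G.cum f = fun v => G.cum f 0 + ∫ x in (0 : ℝ)..v, f x ∂G.μ := by
    funext v
    rw [← intervalIntegral.integral_Iic_sub_Iic hf.integrable.integrableOn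
      hf.integrable.integrableOn, cum, cum]
    ring
  rw [e2]
  exact continuous_const.add
    (intervalIntegral.continuous_primitive (fun _ _ => hf.integrable.intervalIntegrable) 0)

/-- No density of types is needed: the boundary terms of `cum` and `n * tail` cancel up to a product
of increments of `n` and `tail`, which is `o(w - v)` because `tail` is continuous. -/
theorem hasDerivAt_load (hf : G.IsShare f) (h1 : G.A1) {v : ℝ} (hv : v ∈ Ioo G.A G.B) :
    HasDerivAt (G.load f) (deriv G.n v * G.tail f v) v := by
  have hn : HasDerivAt G.n (deriv G.n v) v :=
    ((G.n_diff v hv).differentiableAt (Ioo_mem_nhds hv.1 hv.2)).hasDerivAt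
  have hlin : HasDerivAt (fun w => (G.n w - G.n v) * G.tail f v) (deriv G.n v * G.tail f v) v :=
    (hn.sub_const (G.n v)).mul_const _
  have hrest : HasDerivAt (fun w => G.load f w - G.load f v - (G.n w - G.n v) * G.tail f v) 0
      v := by
    rw [hasDerivAt_iff_isLittleO]
    simp only [sub_self, zero_mul, smul_zero, sub_zero]
    have ho : (fun w => (G.n w - G.n v) * (G.tail f w - G.tail f v)) =o[nhds v]
        fun w => (w - v) * 1 := by
      refine hn.differentiableAt.isBigO_sub.mul_isLittleO ?_
      rw [Asymptotics.isLittleO_one_iff, tendsto_sub_nhds_zero_iff]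
      exact (hf.tail_continuous h1).continuousAt
    simp only [mul_one] at ho
    refine Asymptotics.IsBigO.trans_isLittleO (Asymptotics.IsBigO.of_bound 1 ?_) ho
    filter_upwards [Ioo_mem_nhds hv.1 hv.2] with w hw
    rw [one_mul]
    exact hf.abs_load_sub_le h1 (Ioo_subset_Icc_self hv) (Ioo_subset_Icc_self hw)
  have h := (hrest.add hlin).add_const (G.load f v)
  rw [zero_add] at h
  refine h.congr_of_eventuallyEq (Filter.Eventually.of_forall fun w => ?_)
  simp only [Pi.add_apply]
  ring

end IsShare

theorem invWeight_eq_tail (v : ℝ) : G.invWeight v = G.tail (fun _ => 1) v := by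
  rw [invWeight, integral_Icc_eq_integral_Ioc, tail]
  simp only [one_mul]
  refine setIntegral_congr_set (Filter.eventuallyEq_set.2 ?_)
  filter_upwards [G.ae_mem_Icc] with x hx
  exact ⟨fun h => h.1, fun h => ⟨h, hx.2⟩⟩

end Load

/-! ### Single crossing of the queue costs -/

section Crossing

theorem sum_Ioi_succ {L : ℕ} (a : Fin L → ℝ) (l : ℕ) (h : l + 1 < L) :
    ∑ j ∈ Finset.Ioi (⟨l, Nat.lt_of_succ_lt h⟩ : Fin L), a j
      = a ⟨l + 1, h⟩ + ∑ j ∈ Finset.Ioi (⟨l + 1, h⟩ : Fin L), a j := by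
  have e : Finset.Ioi (⟨l, Nat.lt_of_succ_lt h⟩ : Fin L)
      = insert ⟨l + 1, h⟩ (Finset.Ioi (⟨l + 1, h⟩ : Fin L)) := by
    ext j
    simp only [Finset.mem_Ioi, Finset.mem_insert, Fin.lt_def, Fin.ext_iff]
    omega
  rw [e, Finset.sum_insert (by simp)]

variable {L : ℕ} [NeZero L] (G : BoardingGame L)

theorem m_strictAntiOn : StrictAntiOn G.m (Icc G.A G.B) := by
  refine strictAntiOn_of_deriv_neg (convex_Icc _ _) G.m_cont fun x hx => ?_
  rw [interior_Icc] at hx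
  exact G.m_deriv_neg x hx

theorem m_left_pos : 0 < G.m G.A :=
  (G.m_nonneg _ G.right_mem).trans_lt (G.m_strictAntiOn G.left_mem G.right_mem G.A_lt_B)

/-- Queue choices of all types: a measurable family of probability vectors. -/
structure IsChoice (q : Fin L → ℝ → ℝ) : Prop where
  aemeasurable : ∀ l, AEMeasurable (q l) G.μ
  mem : ∀ x ∈ Icc G.A G.B, (fun l => q l x) ∈ stdSimplex ℝ (Fin L)

/-- The cost of queue `l` for type `v` when all arrival times are in equilibrium. -/
noncomputable def redCost (q : Fin L → ℝ → ℝ) (l : Fin L) (v : ℝ) : ℝ :=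
  congestionCost G.μ G.n G.m G.P G.N q l v

variable {G} {q : Fin L → ℝ → ℝ}

theorem redCost_eq (l : Fin L) (v : ℝ) : G.redCost q l v = G.m v * G.P l
    + G.N * ∑ j ∈ Finset.Ioi l, ∫ x, q j x ∂G.μ + G.N * G.load (q l) v :=
  rfl

theorem IsChoice.isShare (hq : G.IsChoice q) (l : Fin L) : G.IsShare (q l) :=
  ⟨hq.aemeasurable l, fun x hx => (hq.mem x hx).1 l, fun x hx => by
    rw [← (hq.mem x hx).2]
    exact Finset.single_le_sum (fun j _ => (hq.mem x hx).1 j) (Finset.mem_univ l)⟩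

theorem redCost_succ_sub (l : ℕ) (h : l + 1 < L) (v : ℝ) :
    G.redCost q ⟨l + 1, h⟩ v - G.redCost q ⟨l, Nat.lt_of_succ_lt h⟩ v
      = G.m v * (G.P ⟨l + 1, h⟩ - G.P ⟨l, Nat.lt_of_succ_lt h⟩)
        + G.N * (G.load (q ⟨l + 1, h⟩) v - ∫ x, q ⟨l + 1, h⟩ x ∂G.μ)
        - G.N * G.load (q ⟨l, Nat.lt_of_succ_lt h⟩) v := by
  rw [redCost_eq, redCost_eq, sum_Ioi_succ _ l h]
  ring

theorem mul_y_lt (h1 : G.A1) (h2 : G.A2) (l : ℕ) (h : l + 1 < L) {v : ℝ} (hv : v ∈ Ioo G.A G.B) :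
    G.N * G.y v < G.P ⟨l + 1, h⟩ - G.P ⟨l, Nat.lt_of_succ_lt h⟩ := by
  refine lt_of_le_of_lt (mul_le_mul_of_nonneg_left ?_ G.N_pos.le) (h2 l h)
  -- The bound on `y` in (A1) is needed here: `sSup` of an unbounded set would be the default value
  -- `0`.
  refine le_max_of_le_left (le_csSup ?_ (mem_image_of_mem _ hv))
  obtain ⟨C, hC⟩ := h1.1
  refine ⟨C, ?_⟩
  rintro _ ⟨w, hw, rfl⟩
  exact (le_abs_self _).trans (hC w hw)

/-- With `ΔP` the price step, the derivative is `m' * (ΔP - N * y)`, negative by (A2). -/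
theorem strictAntiOn_price_add_load (h1 : G.A1) (h2 : G.A2) (l : ℕ) (h : l + 1 < L) :
    StrictAntiOn (fun v => G.m v * (G.P ⟨l + 1, h⟩ - G.P ⟨l, Nat.lt_of_succ_lt h⟩)
      + G.N * G.load (fun _ => 1) v) (Icc G.A G.B) := by
  refine strictAntiOn_of_deriv_neg (convex_Icc _ _) ?_ fun v hv => ?_
  · exact (G.m_cont.mul continuousOn_const).add
      (continuousOn_const.mul (isShare_one.load_continuousOn h1))
  rw [interior_Icc] at hv
  have hm : HasDerivAt G.m (deriv G.m v) v :=
    ((G.m_diff v hv).differentiableAt (Ioo_mem_nhds hv.1 hv.2)).hasDerivAt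
  have hd := (hm.mul_const (G.P ⟨l + 1, h⟩ - G.P ⟨l, Nat.lt_of_succ_lt h⟩)).add
    ((isShare_one.hasDerivAt_load h1 hv).const_mul G.N)
  have hd' := hd.deriv
  change deriv (fun v => G.m v * (G.P ⟨l + 1, h⟩ - G.P ⟨l, Nat.lt_of_succ_lt h⟩)
      + G.N * G.load (fun _ => 1) v) v = _ at hd'
  rw [hd', ← invWeight_eq_tail v]
  have hy := mul_y_lt h1 h2 l h hv
  have hneg := G.m_deriv_neg v hv
  have hne : -deriv G.m v ≠ 0 := by linarith
  have e : G.N * (deriv G.n v * G.invWeight v) = G.N * G.y v * (-deriv G.m v) := by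
    have h3 := div_mul_cancel₀ (deriv G.n v) hne
    rw [y]
    linear_combination -(G.N * G.invWeight v) * h3
  rw [e]
  nlinarith

/-- Monotone comparison of the costs of two adjacent queues. -/
theorem strictAntiOn_price_add_load_sub (h1 : G.A1) (h2 : G.A2) (l : ℕ) (h : l + 1 < L)
    {f k : ℝ → ℝ} (hf : G.IsShare f) (hk : MonotoneOn k (Icc G.A G.B)) :
    StrictAntiOn (fun v => G.m v * (G.P ⟨l + 1, h⟩ - G.P ⟨l, Nat.lt_of_succ_lt h⟩)
      + G.N * G.load f v - k v) (Icc G.A G.B) := by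
  intro v hv w hw hvw
  have h3 := strictAntiOn_price_add_load h1 h2 l h hv hw hvw
  have h4 := mul_le_mul_of_nonneg_left (hf.load_sub_le h1 hv hw hvw.le) G.N_pos.le
  have h5 := hk hv hw hvw.le
  simp only at h3 ⊢
  linarith

theorem IsChoice.strictAntiOn_redCost_succ_sub (hq : G.IsChoice q) (h1 : G.A1) (h2 : G.A2) (l : ℕ)
    (h : l + 1 < L) : StrictAntiOn (fun v => G.redCost q ⟨l + 1, h⟩ v
      - G.redCost q ⟨l, Nat.lt_of_succ_lt h⟩ v) (Icc G.A G.B) := by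
  have hk : MonotoneOn (fun v => G.N * ∫ x, q ⟨l + 1, h⟩ x ∂G.μ
      + G.N * G.load (q ⟨l, Nat.lt_of_succ_lt h⟩) v) (Icc G.A G.B) := fun v hv w hw hvw =>
    add_le_add_right (mul_le_mul_of_nonneg_left
      ((hq.isShare _).load_monotoneOn h1 hv hw hvw) G.N_pos.le) _
  refine (strictAntiOn_price_add_load_sub h1 h2 l h (hq.isShare ⟨l + 1, h⟩) hk).congr
    fun v _ => ?_
  rw [redCost_succ_sub]
  ring

theorem IsChoice.strictAntiOn_redCost_sub (hq : G.IsChoice q) (h1 : G.A1) (h2 : G.A2)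
    {k l : Fin L} (hkl : k < l) :
    StrictAntiOn (fun v => G.redCost q l v - G.redCost q k v) (Icc G.A G.B) := by
  obtain ⟨k, hk⟩ := k
  obtain ⟨l, hl⟩ := l
  rw [Fin.mk_lt_mk] at hkl
  induction l, hkl using Nat.le_induction with
  | base => exact hq.strictAntiOn_redCost_succ_sub h1 h2 k hl
  | succ l hkl ih =>
    intro v hv w hw hvw
    have h3 := ih (Nat.lt_of_succ_lt hl) hv hw hvw
    have h4 := hq.strictAntiOn_redCost_succ_sub h1 h2 l hl hv hw hvw
    simp only at h3 h4 ⊢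
    linarith

/-- At `A` the price step costs more than `2 * N`, while congestion can favour the higher queue by
at most `N` in each of the two queues. -/
theorem IsChoice.redCost_lt_left (hq : G.IsChoice q) (h2 : G.A2) (l : ℕ) (h : l + 1 < L) :
    G.redCost q ⟨l, Nat.lt_of_succ_lt h⟩ G.A < G.redCost q ⟨l + 1, h⟩ G.A := by
  rw [← sub_pos, redCost_succ_sub]
  have h3 : G.N * (2 / G.m G.A) < G.P ⟨l + 1, h⟩ - G.P ⟨l, Nat.lt_of_succ_lt h⟩ :=
    lt_of_le_of_lt (mul_le_mul_of_nonneg_left (le_max_right _ _) G.N_pos.le) (h2 l h)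
  have h4 : G.N * 2 < G.m G.A * (G.P ⟨l + 1, h⟩ - G.P ⟨l, Nat.lt_of_succ_lt h⟩) := by
    have := mul_lt_mul_of_pos_left h3 G.m_left_pos
    have e : G.m G.A * (G.N * (2 / G.m G.A)) = G.N * 2 := by
      have := G.m_left_pos.ne'
      field_simp
    linarith
  have h5 := (hq.isShare ⟨l + 1, h⟩).load_nonneg G.left_mem
  have h6 := (hq.isShare ⟨l + 1, h⟩).integral_le_one
  have h7 := (hq.isShare ⟨l, Nat.lt_of_succ_lt h⟩).load_le G.left_mem
  have h8 := (hq.isShare ⟨l, Nat.lt_of_succ_lt h⟩).integral_le_one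
  have h9 := G.N_pos
  nlinarith

theorem IsChoice.redCost_right_sub (hq : G.IsChoice q) (l : ℕ) (h : l + 1 < L) :
    G.redCost q ⟨l + 1, h⟩ G.B - G.redCost q ⟨l, Nat.lt_of_succ_lt h⟩ G.B
      = G.m G.B * (G.P ⟨l + 1, h⟩ - G.P ⟨l, Nat.lt_of_succ_lt h⟩)
        - G.N * ∫ x, q ⟨l, Nat.lt_of_succ_lt h⟩ x ∂G.μ := by
  rw [redCost_succ_sub, (hq.isShare _).load_right, (hq.isShare _).load_right]
  ring

theorem IsChoice.continuousOn_redCost (hq : G.IsChoice q) (h1 : G.A1) (l : Fin L) :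
    ContinuousOn (G.redCost q l) (Icc G.A G.B) :=
  ((G.m_cont.mul continuousOn_const).add continuousOn_const).add
    (continuousOn_const.mul ((hq.isShare l).load_continuousOn h1))

end Crossing

end BoardingGame

/-- A function whose increments are bounded by products of increments of two functions, one of
them continuous, is constant. -/
theorem eq_of_abs_sub_le_mul_sub {φ α β : ℝ → ℝ} {a b : ℝ} (hab : a ≤ b)
    (hβ : ContinuousOn β (Icc a b))
    (h : ∀ v ∈ Icc a b, ∀ w ∈ Icc a b, v ≤ w → |φ w - φ v| ≤ (α w - α v) * (β w - β v)) :
    φ a = φ b := by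
  have key : ∀ k : ℕ, ∀ v ∈ Icc a b, ∀ w ∈ Icc a b, v ≤ w →
      |φ w - φ v| ≤ (1 / 2) ^ k * ((α w - α v) * (β w - β v)) := by
    intro k
    induction k with
    | zero => simpa using h
    | succ k ih =>
      intro v hv w hw hvw
      have hsub : Icc v w ⊆ Icc a b := Icc_subset_Icc hv.1 hw.2
      -- Cutting where `β` is halfway makes the two bounds add up to half the original one, whatever
      -- `α` does.
      have hconn : (β v + β w) / 2 ∈ β '' Icc v w := by
        rcases le_total (β v) (β w) with h' | h'
        · exact intermediate_value_Icc hvw (hβ.mono hsub) ⟨by linarith, by linarith⟩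
        · exact intermediate_value_Icc' hvw (hβ.mono hsub) ⟨by linarith, by linarith⟩
      obtain ⟨c, hc, hβc⟩ := hconn
      have h1 := ih v hv c (hsub hc) hc.1
      have h2 := ih c (hsub hc) w hw hc.2
      have h3 : |φ w - φ v| ≤ |φ w - φ c| + |φ c - φ v| := abs_sub_le _ _ _
      rw [hβc] at h1 h2
      rw [pow_succ]
      linarith
  have hlim : Filter.Tendsto (fun k : ℕ => (1 / 2 : ℝ) ^ k * ((α b - α a) * (β b - β a)))
      Filter.atTop (nhds (0 * ((α b - α a) * (β b - β a)))) :=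
    (tendsto_pow_atTop_nhds_zero_of_lt_one (by norm_num) (by norm_num)).mul_const _
  rw [zero_mul] at hlim
  have h0 : |φ b - φ a| ≤ 0 := ge_of_tendsto' hlim fun k =>
    key k a (left_mem_Icc.2 hab) b (right_mem_Icc.2 hab) hab
  linarith [abs_nonpos_iff.1 h0]

/-! ### Equilibrium arrival times in one queue -/

namespace BoardingGame

section Timing

variable {L : ℕ} [NeZero L] (G : BoardingGame L)

/-- The fraction of customers who join a queue with probability `f` and wait there for `t` or
longer, if they arrive at the times `τ`. -/
noncomputable def waiting (f τ : ℝ → ℝ) (t : ℝ) : ℝ :=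
  ∫ v in Icc G.A G.B, {v | t ≤ τ v}.indicator f v ∂G.μ

/-- Equilibrium of the arrival times in a single queue. -/
structure IsTiming (f τ : ℝ → ℝ) : Prop where
  aemeasurable : AEMeasurable τ G.μ
  nonneg : ∀ v ∈ Icc G.A G.B, 0 ≤ τ v
  argmin : ∀ v ∈ Icc G.A G.B, ∀ t, 0 ≤ t →
    G.N * G.waiting f τ (τ v) + G.n v * G.g (τ v) ≤ G.N * G.waiting f τ t + G.n v * G.g t

variable {G} {f τ : ℝ → ℝ}

theorem waiting_eq (f τ : ℝ → ℝ) (t : ℝ) :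
    G.waiting f τ t = ∫ v, {v | t ≤ τ v}.indicator f v ∂G.μ := by
  rw [waiting, G.restrict_Icc]

theorem IsShare.integrable_indicator_le (hf : G.IsShare f) (hτ : AEMeasurable τ G.μ) (t : ℝ) :
    Integrable ({x | t ≤ τ x}.indicator f) G.μ :=
  hf.integrable.indicator₀ (hτ.nullMeasurableSet_preimage (measurableSet_Ici (a := t)))

theorem IsShare.integrable_indicator_eq (hf : G.IsShare f) (hτ : AEMeasurable τ G.μ) (t : ℝ) :
    Integrable ({x | τ x = t}.indicator f) G.μ :=
  hf.integrable.indicator₀ (hτ.nullMeasurableSet_preimage (measurableSet_singleton t))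

theorem waiting_zero (hτ : ∀ v ∈ Icc G.A G.B, 0 ≤ τ v) :
    G.waiting f τ 0 = ∫ x, f x ∂G.μ := by
  rw [waiting_eq]
  refine integral_congr_ae ?_
  filter_upwards [G.ae_mem_Icc] with x hx
  exact indicator_of_mem (s := {v | 0 ≤ τ v}) (hτ x hx) f

namespace IsTiming

/-- Exchange argument: adding the optimality of each type against the other's time gives `(n w - n
v) * (g (τ w) - g (τ v)) ≤ 0`. -/
theorem antitoneOn (hT : G.IsTiming f τ) : AntitoneOn τ (Icc G.A G.B) := by
  intro v hv w hw hvw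
  rcases hvw.eq_or_lt with rfl | hvw
  · exact le_rfl
  rw [← G.g_strictMono.le_iff_le (hT.nonneg w hw) (hT.nonneg v hv)]
  have h1 := hT.argmin v hv _ (hT.nonneg w hw)
  have h2 := hT.argmin w hw _ (hT.nonneg v hv)
  have h3 := G.n_strictMono hv hw hvw
  by_contra! hc
  nlinarith [mul_pos (sub_pos.2 h3) (sub_pos.2 hc)]

/-- The distribution of the arrival times has no atoms. -/
theorem integral_atom (hT : G.IsTiming f τ) (hf : G.IsShare f) {v : ℝ} (hv : v ∈ Icc G.A G.B) :
    ∫ x, {x | τ x = τ v}.indicator f x ∂G.μ ≤ 0 := by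
  set t := τ v
  have ht : 0 ≤ t := hT.nonneg v hv
  -- Arriving slightly earlier, at `s > t`, overtakes the whole atom, at a waiting cost that tends
  -- to zero.
  have hstep : ∀ s, t < s → G.N * ∫ x, {x | τ x = t}.indicator f x ∂G.μ
      ≤ G.n v * (G.g s - G.g t) := by
    intro s hs
    have h1 : G.waiting f τ s + ∫ x, {x | τ x = t}.indicator f x ∂G.μ ≤ G.waiting f τ t := by
      have hi := hf.integrable_indicator_le hT.aemeasurable s
      have hi2 := hf.integrable_indicator_eq hT.aemeasurable t
      rw [waiting_eq, waiting_eq, ← integral_add hi hi2]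
      refine integral_mono_ae (hi.add hi2) (hf.integrable_indicator_le hT.aemeasurable t) ?_
      filter_upwards [hf.ae_nonneg] with x hx
      simp only [indicator_apply, mem_ofPred_eq]
      split_ifs <;> linarith
    have h2 := hT.argmin v hv s (ht.trans hs.le)
    have h3 := mul_le_mul_of_nonneg_left h1 G.N_pos.le
    change G.N * G.waiting f τ t + G.n v * G.g t ≤ _ at h2
    linarith
  have hlim : Filter.Tendsto (fun s => G.n v * (G.g s - G.g t)) (nhdsWithin t (Ioi t))
      (nhds (G.n v * (G.g t - G.g t))) := by
    have hc : ContinuousWithinAt G.g (Ioi t) t :=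
      (G.g_diff t ht).continuousWithinAt.mono fun s hs => ht.trans (le_of_lt hs)
    exact (hc.tendsto.sub_const _).const_mul _
  rw [sub_self, mul_zero] at hlim
  have h0 := ge_of_tendsto hlim (by
    filter_upwards [self_mem_nhdsWithin] with s hs using hstep s hs)
  exact nonpos_of_mul_nonpos_right h0 G.N_pos

/-- Times decrease in the type, so types up to `v` are counted; a higher type is counted only in a
tie with `v`, and ties carry no mass. -/
theorem waiting_eq_cum (hT : G.IsTiming f τ) (hf : G.IsShare f) {v : ℝ} (hv : v ∈ Icc G.A G.B) :
    G.waiting f τ (τ v) = G.cum f v := by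
  have hi := hf.integrable_indicator_le hT.aemeasurable (τ v)
  have hi2 := hf.integrable_indicator_eq hT.aemeasurable (τ v)
  have hi3 : Integrable ((Iic v).indicator f) G.μ := hf.integrable.indicator measurableSet_Iic
  rw [waiting_eq, cum, ← integral_indicator measurableSet_Iic]
  refine le_antisymm ?_ ?_
  · have h := hT.integral_atom hf hv
    have h2 : ∫ x, {x | τ v ≤ τ x}.indicator f x ∂G.μ
        ≤ ∫ x, ((Iic v).indicator f x + {x | τ x = τ v}.indicator f x) ∂G.μ := by
      refine integral_mono_ae hi (hi3.add hi2) ?_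
      filter_upwards [G.ae_mem_Icc] with x hx
      have hx0 := hf.nonneg x hx
      simp only [indicator_apply, mem_ofPred_eq, mem_Iic]
      split_ifs with h1 h2 <;> try linarith
      exact absurd (le_antisymm (hT.antitoneOn hv hx (not_le.1 h2).le) h1) (by assumption)
    rw [integral_add hi3 hi2] at h2
    linarith
  · refine integral_mono_ae hi3 hi ?_
    filter_upwards [G.ae_mem_Icc] with x hx
    have hx0 := hf.nonneg x hx
    simp only [indicator_apply, mem_ofPred_eq, mem_Iic]
    split_ifs with h1 h2 <;> try linarith
    exact absurd (hT.antitoneOn hx hv h1) h2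

theorem g_sub_bounds (hT : G.IsTiming f τ) (hf : G.IsShare f) {v w : ℝ} (hv : v ∈ Icc G.A G.B)
    (hw : w ∈ Icc G.A G.B) :
    G.n v * (G.g (τ v) - G.g (τ w)) ≤ G.N * (G.cum f w - G.cum f v) ∧
      G.N * (G.cum f w - G.cum f v) ≤ G.n w * (G.g (τ v) - G.g (τ w)) := by
  have h1 := hT.argmin v hv _ (hT.nonneg w hw)
  have h2 := hT.argmin w hw _ (hT.nonneg v hv)
  rw [hT.waiting_eq_cum hf hv, hT.waiting_eq_cum hf hw] at h1 h2
  constructor <;> linarith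

/-- Type `B` has the whole queue ahead of it, as it would when arriving at time `0`, so it gains
nothing by waiting. -/
theorem g_right (hT : G.IsTiming f τ) (hf : G.IsShare f) : G.g (τ G.B) = 0 := by
  have h1 := hT.argmin _ G.right_mem 0 le_rfl
  rw [waiting_zero hT.nonneg, hT.waiting_eq_cum hf G.right_mem, IsShare.cum_right, G.g_zero] at h1
  have h2 : 0 < G.n G.B := G.n_pos ⟨G.A_lt_B, le_rfl⟩
  refine le_antisymm (nonpos_of_mul_nonpos_right (by linarith) h2) ?_
  rw [← G.g_zero]
  exact G.g_strictMono.monotoneOn self_mem_Ici (hT.nonneg _ G.right_mem) (hT.nonneg _ G.right_mem)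

/-- The equilibrium arrival times are determined by the queue choices. -/
theorem g_eq (hT : G.IsTiming f τ) (hf : G.IsShare f) (h1 : G.A1) {v : ℝ} (hv : v ∈ Icc G.A G.B)
    (hn : 0 < G.n v) : G.g (τ v) = G.N * G.tail f v := by
  have hsub : Icc v G.B ⊆ Icc G.A G.B := Icc_subset_Icc_left hv.1
  have hpos : ∀ w ∈ Icc v G.B, 0 < G.n w := fun w hw =>
    hn.trans_le (G.n_strictMono.monotoneOn hv (hsub hw) hw.1)
  -- Decrements of `g ∘ τ` and of `N * tail f` both lie between the increment of `N * cum f` divided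
  -- by `n y` and by `n x`. Their difference is thus bounded by a product of increments, with `1 /
  -- n` continuous, and is constant.
  have key : G.g (τ v) - G.N * G.tail f v = G.g (τ G.B) - G.N * G.tail f G.B := by
    refine eq_of_abs_sub_le_mul_sub (φ := fun v => G.g (τ v) - G.N * G.tail f v)
      (α := fun v => G.N * G.cum f v) (β := fun v => -(1 / G.n v)) hv.2 ?_ ?_
    · exact (continuousOn_const.div (G.n_cont.mono hsub) fun w hw => (hpos w hw).ne').neg
    · intro x hx y hy hxy
      obtain ⟨h2, h3⟩ := hT.g_sub_bounds hf (hsub hx) (hsub hy)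
      obtain ⟨h4, h5⟩ := hf.cum_sub_bounds h1 (hsub hx) (hsub hy) hxy
      have hxn := hpos x hx
      have hyn := hpos y hy
      set a := G.g (τ x) - G.g (τ y)
      set b := G.tail f x - G.tail f y
      set d := G.cum f y - G.cum f x
      have h4' : G.n x * (G.N * b) ≤ G.N * d := by nlinarith [G.N_pos]
      have h5' : G.N * d ≤ G.n y * (G.N * b) := by nlinarith [G.N_pos]
      have e1 : a ≤ G.N * d * (1 / G.n x) := by
        rw [mul_one_div, le_div_iff₀ hxn]; linarith
      have e2 : G.N * d * (1 / G.n y) ≤ a := by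
        rw [mul_one_div, div_le_iff₀ hyn]; linarith
      have e3 : G.N * b ≤ G.N * d * (1 / G.n x) := by
        rw [mul_one_div, le_div_iff₀ hxn]; linarith
      have e4 : G.N * d * (1 / G.n y) ≤ G.N * b := by
        rw [mul_one_div, div_le_iff₀ hyn]; linarith
      have e5 : (G.g (τ y) - G.N * G.tail f y) - (G.g (τ x) - G.N * G.tail f x)
          = G.N * b - a := by ring
      have e6 : (G.N * G.cum f y - G.N * G.cum f x) * (-(1 / G.n y) - -(1 / G.n x))
          = G.N * d * (1 / G.n x) - G.N * d * (1 / G.n y) := by ring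
      rw [e5, e6, abs_le]
      constructor <;> linarith
  rw [hT.g_right hf, IsShare.tail_right] at key
  linarith

theorem cost_eq (hT : G.IsTiming f τ) (hf : G.IsShare f) (h1 : G.A1) {v : ℝ}
    (hv : v ∈ Icc G.A G.B) :
    G.N * G.waiting f τ (τ v) + G.n v * G.g (τ v) = G.N * G.load f v := by
  rw [hT.waiting_eq_cum hf hv, hf.load_eq hv]
  -- If `n v = 0`, `g_eq` does not apply, but the waiting term has no weight.
  rcases (G.n_nonneg' hv).eq_or_lt with h | h
  · rw [← h]
    ring
  · rw [hT.g_eq hf h1 hv h]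
    ring

end IsTiming

end Timing

/-! ### Reduction of Nash equilibria to queue choices -/

section Nash

variable {L : ℕ} [NeZero L] {G : BoardingGame L} {σ : Policy L}

theorem F_eq_waiting (σ : Policy L) (l : Fin L) (t : ℝ) :
    G.F σ l t = G.waiting (σ.q l) (σ.T l) t :=
  rfl

theorem F_zero_eq {l : Fin L} (hT : G.IsTiming (σ.q l) (σ.T l)) :
    G.F σ l 0 = ∫ x, σ.q l x ∂G.μ :=
  waiting_zero hT.nonneg

theorem IsChoice.joinCost_eq (hq : G.IsChoice σ.q) (hT : ∀ l, G.IsTiming (σ.q l) (σ.T l))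
    (h1 : G.A1) (l : Fin L) {v : ℝ} (hv : v ∈ Icc G.A G.B) :
    G.joinCost σ l v = G.redCost σ.q l v := by
  have h := (hT l).cost_eq (hq.isShare l) h1 hv
  rw [redCost_eq, ← h, joinCost, cost, F_eq_waiting σ l]
  simp only [F_zero_eq (hT _)]
  ring

variable (G) in
/-- Queue choices that are optimal for every type, given that arrival times are in equilibrium. -/
structure IsReducedNash (q : Fin L → ℝ → ℝ) : Prop extends G.IsChoice q where
  le_of_ne_zero : ∀ x ∈ Icc G.A G.B, ∀ l, q l x ≠ 0 → ∀ j, G.redCost q l x ≤ G.redCost q j x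

namespace IsNash

theorem isChoice (hσ : G.IsNash σ) : G.IsChoice σ.q :=
  ⟨hσ.aemeasurable_q, hσ.q_mem⟩

theorem isTiming (hσ : G.IsNash σ) (l : Fin L) : G.IsTiming (σ.q l) (σ.T l) := by
  refine ⟨hσ.aemeasurable_T l, fun v hv => hσ.T_nonneg v hv l, fun v hv t ht => ?_⟩
  have h : G.cost σ v l (σ.T l v) ≤ G.cost σ v l t := hσ.T_argmin v hv l ht
  simp only [cost, F_eq_waiting] at h
  linarith

theorem F_zero (hσ : G.IsNash σ) (l : Fin L) : G.F σ l 0 = ∫ x, σ.q l x ∂G.μ :=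
  F_zero_eq (hσ.isTiming l)

theorem joinCost_eq (hσ : G.IsNash σ) (h1 : G.A1) (l : Fin L) {v : ℝ} (hv : v ∈ Icc G.A G.B) :
    G.joinCost σ l v = G.redCost σ.q l v :=
  hσ.isChoice.joinCost_eq hσ.isTiming h1 l hv

theorem isReducedNash (hσ : G.IsNash σ) (h1 : G.A1) : G.IsReducedNash σ.q := by
  refine ⟨hσ.isChoice, fun x hx l hl => ?_⟩
  obtain ⟨k, hk, -⟩ := exists_leastArgmin_eq_single fun j => G.redCost σ.q j x
  have h := hσ.q_argmin x hx (single_mem_stdSimplex ℝ k)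
  refine le_of_ne_zero_of_sum_le (c := fun j => G.redCost σ.q j x) (hσ.q_mem x hx) hk ?_ hl
  simp only [mem_ofPred_eq, hσ.joinCost_eq h1 _ hx] at h
  refine h.trans_eq ?_
  rw [Finset.sum_eq_single k]
  · simp
  · intro j _ hj
    simp [Pi.single_eq_of_ne hj]
  · simp

theorem T_eq_of_q_ae_eq {σ' : Policy L} (hσ : G.IsNash σ) (hσ' : G.IsNash σ') (h1 : G.A1)
    {l : Fin L} (hq : σ.q l =ᵐ[G.μ] σ'.q l) {x : ℝ} (hx : x ∈ Icc G.A G.B) (hn : 0 < G.n x) :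
    σ.T l x = σ'.T l x := by
  refine G.g_strictMono.injOn (hσ.T_nonneg x hx l) (hσ'.T_nonneg x hx l) ?_
  rw [(hσ.isTiming l).g_eq (hσ.isChoice.isShare l) h1 hx hn,
    (hσ'.isTiming l).g_eq (hσ'.isChoice.isShare l) h1 hx hn, tail, tail]
  congr 1
  refine integral_congr_ae (ae_restrict_of_ae ?_)
  filter_upwards [hq] with z hz
  rw [hz]

end IsNash

end Nash

/-! ### Existence of equilibria -/

section Existence

variable {L : ℕ} [NeZero L] {G : BoardingGame L} {f : ℝ → ℝ}

/-- Equilibrium arrival times exist in a queue with given joining probabilities. -/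
theorem IsShare.exists_isTiming (hf : G.IsShare f) (hg : G.WaitRange) (h1 : G.A1) :
    ∃ τ, G.IsTiming f τ := by
  obtain ⟨t₀, ht₀, hgt₀⟩ := hg
  have hle : ∀ v, G.N * G.tail f v ≤ G.g t₀ := by
    intro v
    rw [hgt₀]
    refine mul_le_mul_of_nonneg_left ?_ G.N_pos.le
    rw [invWeight, G.restrict_Icc]
    calc G.tail f v ≤ ∫ x, f x * (1 / G.n x) ∂G.μ :=
          setIntegral_le_integral (hf.integrable_div h1) hf.ae_div_nonneg
      _ ≤ ∫ x, 1 / G.n x ∂G.μ := by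
          refine integral_mono_ae (hf.integrable_div h1) h1.integrable_inv ?_
          filter_upwards [G.ae_mem_Icc] with x hx
          exact mul_le_of_le_one_left (one_div_nonneg.2 (G.n_nonneg' hx)) (hf.le_one x hx)
  -- The formula that equilibrium times must satisfy serves as their definition.
  have hex : ∀ v, ∃ t, 0 ≤ t ∧ G.g t = G.N * G.tail f v := by
    intro v
    have hc : ContinuousOn G.g (Icc 0 t₀) := G.g_diff.continuousOn.mono Icc_subset_Ici_self
    obtain ⟨t, ht, h⟩ := intermediate_value_Icc ht₀ hc (show G.N * G.tail f v ∈ _ from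
      ⟨by rw [G.g_zero]; exact mul_nonneg G.N_pos.le (hf.tail_nonneg v), hle v⟩)
    exact ⟨t, ht.1, h⟩
  choose τ hτ0 hτ using hex
  have hτle : ∀ t, 0 ≤ t → ∀ x, t ≤ τ x ↔ G.g t ≤ G.N * G.tail f x := by
    intro t ht x
    rw [← hτ x, G.g_strictMono.le_iff_le ht (hτ0 x)]
  have hanti : Antitone τ := fun v w hvw => by
    rw [hτle _ (hτ0 w), hτ]
    exact mul_le_mul_of_nonneg_left (hf.tail_anti h1 hvw) G.N_pos.le
  have hτm : AEMeasurable τ G.μ := hanti.measurable.aemeasurable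
  refine ⟨τ, hτm, fun v _ => hτ0 v, fun v hv t ht => ?_⟩
  -- Types above `v` may share its arrival time. They lie below the last type `u` with the same
  -- `tail`, and the types between `v` and `u` carry no `f`-mass.
  have hupper : G.waiting f τ (τ v) ≤ G.cum f v := by
    have hK : IsCompact (Icc v G.B ∩ {x | G.tail f x = G.tail f v}) :=
      isCompact_Icc.inter_right (isClosed_eq (hf.tail_continuous h1) continuous_const)
    obtain ⟨u, ⟨⟨hvu, huB⟩, hu⟩, hmax⟩ := hK.exists_isGreatest ⟨v, ⟨le_rfl, hv.2⟩, rfl⟩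
    have hcum : G.cum f u ≤ G.cum f v := by
      have h := (hf.cum_sub_bounds h1 hv ⟨hv.1.trans hvu, huB⟩ hvu).2
      rw [show G.tail f u = G.tail f v from hu, sub_self, mul_zero] at h
      linarith
    refine le_trans ?_ hcum
    rw [waiting_eq, cum, ← integral_indicator measurableSet_Iic]
    refine integral_mono_ae (hf.integrable_indicator_le hτm _)
      (hf.integrable.indicator measurableSet_Iic) ?_
    filter_upwards [G.ae_mem_Icc] with x hx
    have hx0 := hf.nonneg x hx
    simp only [indicator_apply, mem_ofPred_eq, mem_Iic]
    split_ifs with h2 h3 <;> try linarith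
    exfalso
    rw [hτle _ (hτ0 v), hτ] at h2
    have h4 := le_of_mul_le_mul_left h2 G.N_pos
    have h5 : v ≤ x := hvu.trans (not_le.1 h3).le
    exact h3 (hmax ⟨⟨h5, hx.2⟩, le_antisymm (hf.tail_anti h1 h5) h4⟩)
  -- Any time `t` is at least as costly as imitating some type `u`, where `u = A` if `t` is earlier
  -- than every arrival. Among types, imitating oneself is best: `cum f u + n v * tail f u` is
  -- minimal at `u = v`.
  have hlower : G.N * G.load f v ≤ G.N * G.waiting f τ t + G.n v * G.g t := by
    obtain ⟨u, hu, hut, hgu⟩ : ∃ u ∈ Icc G.A G.B, G.cum f u ≤ G.waiting f τ t ∧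
        G.N * G.tail f u ≤ G.g t := by
      have hgt : 0 ≤ G.g t := by
        rw [← G.g_zero]
        exact G.g_strictMono.monotoneOn self_mem_Ici ht ht
      rcases le_total (G.N * G.tail f G.A) (G.g t) with h | h
      · refine ⟨G.A, G.left_mem, ?_, h⟩
        rw [IsShare.cum_left, waiting_eq]
        refine integral_nonneg_of_ae ?_
        filter_upwards [hf.ae_nonneg] with x hx
        exact indicator_apply_nonneg fun _ => hx
      · have hc : ContinuousOn (fun x => G.N * G.tail f x) (Icc G.A G.B) :=
          ((hf.tail_continuous h1).const_mul G.N).continuousOn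
        obtain ⟨u, hu, hgu⟩ := intermediate_value_Icc' G.A_lt_B.le hc
          (show G.g t ∈ _ from ⟨by rw [IsShare.tail_right, mul_zero]; exact hgt, h⟩)
        refine ⟨u, hu, ?_, hgu.le⟩
        rw [waiting_eq, cum, ← integral_indicator measurableSet_Iic]
        refine integral_mono_ae (hf.integrable.indicator measurableSet_Iic)
          (hf.integrable_indicator_le hτm _) ?_
        filter_upwards [G.ae_mem_Icc] with x hx
        have hx0 := hf.nonneg x hx
        simp only [indicator_apply, mem_ofPred_eq, mem_Iic]
        split_ifs with h2 h3 <;> try linarith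
        refine absurd ?_ h3
        rw [hτle t ht, ← hgu]
        exact mul_le_mul_of_nonneg_left (hf.tail_anti h1 h2) G.N_pos.le
    have hkey : G.load f v ≤ G.cum f u + G.n v * G.tail f u := by
      rw [hf.load_eq hv]
      rcases le_total u v with h | h
      · linarith [(hf.cum_sub_bounds h1 hu hv h).2]
      · linarith [(hf.cum_sub_bounds h1 hv hu h).1]
    have e1 := mul_le_mul_of_nonneg_left hkey G.N_pos.le
    have e2 := mul_le_mul_of_nonneg_left hut G.N_pos.le
    have e3 := mul_le_mul_of_nonneg_left hgu (G.n_nonneg' hv)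
    linarith
  refine le_trans ?_ hlower
  rw [hf.load_eq hv, hτ v]
  have := mul_le_mul_of_nonneg_left hupper G.N_pos.le
  linarith

variable {q : Fin L → ℝ → ℝ}

theorem IsReducedNash.exists_isNash (hq : G.IsReducedNash q) (hg : G.WaitRange) (h1 : G.A1) :
    ∃ σ : Policy L, G.IsNash σ ∧ σ.q = q := by
  choose T hT using fun l => (hq.isShare l).exists_isTiming hg h1
  refine ⟨⟨T, q⟩, ⟨fun l => (hT l).aemeasurable, hq.aemeasurable,
    fun v hv l => (hT l).nonneg v hv, fun v hv l t ht => ?_, hq.mem, fun v hv r hr => ?_⟩, rfl⟩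
  · have h := (hT l).argmin v hv t ht
    simp only [mem_ofPred_eq, cost, F_eq_waiting]
    linarith
  · have hc : ∀ l, G.joinCost ⟨T, q⟩ l v = G.redCost q l v := fun l =>
      IsChoice.joinCost_eq (σ := ⟨T, q⟩) hq.toIsChoice hT h1 l hv
    simp only [mem_ofPred_eq, hc]
    obtain ⟨k, hk, -⟩ := exists_leastArgmin_eq_single fun j => G.redCost q j v
    refine le_trans ?_ (stdSimplex_sum_mul_ge hr hk)
    calc ∑ l, q l v * G.redCost q l v ≤ ∑ l, q l v * G.redCost q k v := by
          refine Finset.sum_le_sum fun l _ => ?_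
          rcases eq_or_ne (q l v) 0 with h | h
          · rw [h, zero_mul, zero_mul]
          · exact mul_le_mul_of_nonneg_left (hq.le_of_ne_zero v hv l h k) ((hq.mem v hv).1 l)
      _ = G.redCost q k v := by rw [← Finset.sum_mul, (hq.mem v hv).2, one_mul]

/-- Choices enter the costs only through integrals, so they can be altered on null sets. -/
theorem redCost_congr {q' : Fin L → ℝ → ℝ} (h : ∀ l, q l =ᵐ[G.μ] q' l) :
    G.redCost q = G.redCost q' := by
  funext l v
  rw [redCost_eq, redCost_eq, load, load]
  congr 2
  · congr 1
    exact Finset.sum_congr rfl fun j _ => integral_congr_ae (h j)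
  · refine integral_congr_ae ?_
    filter_upwards [h l] with x hx
    rw [hx]

/-- A strictly monotone cost difference vanishes at most once, and points are null. -/
theorem IsChoice.ae_redCost_ne (hq : G.IsChoice q) (h1 : G.A1) (h2 : G.A2) :
    ∀ᵐ x ∂G.μ, ∀ k l, k < l → G.redCost q k x ≠ G.redCost q l x := by
  refine ae_all_iff.2 fun k => ae_all_iff.2 fun l => ?_
  by_cases hkl : k < l
  swap
  · exact Filter.Eventually.of_forall fun x h => absurd h hkl
  have hs : ({x | x ∈ Icc G.A G.B ∧ G.redCost q k x = G.redCost q l x}).Subsingleton := by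
    intro x hx y hy
    refine (hq.strictAntiOn_redCost_sub h1 h2 hkl).injOn hx.1 hy.1 ?_
    rw [hx.2, hy.2, sub_self, sub_self]
  have h0 := hs.measure_zero G.μ
  have h0' : ∀ᵐ x ∂G.μ, ¬(x ∈ Icc G.A G.B ∧ G.redCost q k x = G.redCost q l x) := by
    rw [ae_iff]
    simpa only [not_not] using h0
  filter_upwards [G.ae_mem_Icc, h0'] with x hx h _ he
  exact h ⟨hx, he⟩

/-- There are equilibrium queue choices where each type joins the first of its optimal queues. -/
theorem exists_isReducedNash (h1 : G.A1) (h2 : G.A2) :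
    ∃ q, G.IsReducedNash q ∧ ∀ x l, q l x = leastArgmin (fun j => G.redCost q j x) l := by
  classical
  have hmeas : ∀ k : ℝ → ℝ, ContinuousOn k (Icc G.A G.B) →
      Measurable ((Icc G.A G.B).indicator k) := fun k hk => by
    rw [← piecewise_eq_indicator]
    exact hk.measurable_piecewise continuousOn_const measurableSet_Icc
  obtain ⟨q₀, hq₀m, hq₀⟩ := exists_ae_bestReply (L := L) (μ := G.μ) (hmeas _ G.n_cont)
    (indicator_nonneg fun x hx => G.n_nonneg' hx) (by
      filter_upwards [G.ae_mem_Ioc] with x hx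
      rw [indicator_of_mem (Ioc_subset_Icc_self hx)]
      exact G.n_pos hx) (hmeas _ G.m_cont) (C := G.m G.A) (fun x => by
      by_cases hx : x ∈ Icc G.A G.B
      · rw [indicator_of_mem hx, abs_of_nonneg (G.m_nonneg x hx)]
        exact G.m_strictAntiOn.antitoneOn G.left_mem hx hx.1
      · rw [indicator_of_notMem hx, abs_zero]
        exact G.m_left_pos.le) G.P G.N_pos.le
  have hcost : ∀ x ∈ Icc G.A G.B, ∀ l, congestionCost G.μ ((Icc G.A G.B).indicator G.n)
      ((Icc G.A G.B).indicator G.m) G.P G.N q₀ l x = G.redCost q₀ l x := by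
    intro x hx l
    rw [redCost, congestionCost, congestionCost, indicator_of_mem hx, indicator_of_mem hx]
    congr 2
    refine integral_congr_ae ?_
    filter_upwards [G.ae_mem_Icc] with z hz
    rw [indicator_of_mem hz]
  -- First repair: on the null set where `q₀` is not a probability vector, any fixed one will do.
  let q₁ : Fin L → ℝ → ℝ := fun l x =>
    if (fun l => q₀ l x) ∈ stdSimplex ℝ (Fin L) then q₀ l x else leastArgmin 0 l
  have hq₁ : ∀ l, q₁ l =ᵐ[G.μ] q₀ l := fun l => by
    filter_upwards [hq₀] with x hx
    exact if_pos hx.1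
  have hc₁ : G.IsChoice q₁ := by
    refine ⟨fun l => (hq₀m l).aemeasurable.congr (hq₁ l).symm, fun x _ => ?_⟩
    by_cases hx : (fun l => q₀ l x) ∈ stdSimplex ℝ (Fin L)
    · simpa only [q₁, if_pos hx] using hx
    · simpa only [q₁, if_neg hx] using leastArgmin_mem_stdSimplex 0
  have e₁ : G.redCost q₁ = G.redCost q₀ := redCost_congr hq₁
  -- Second repair: best replies at every type. As ties are null, `q₂` equals `q₁` almost
  -- everywhere, so it is a best reply to itself.
  let q₂ : Fin L → ℝ → ℝ := fun l x => leastArgmin (fun j => G.redCost q₁ j x) l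
  have hae : ∀ᵐ x ∂G.μ, (fun l => q₁ l x) = leastArgmin fun j => G.redCost q₁ j x := by
    filter_upwards [hq₀, G.ae_mem_Icc, hc₁.ae_redCost_ne h1 h2, ae_all_iff.2 hq₁]
      with x hx hxI hne hxq
    refine eq_leastArgmin_of_ne (hc₁.mem x hxI) hne fun l hl j => ?_
    rw [e₁, ← hcost x hxI, ← hcost x hxI]
    exact hx.2 l (by rwa [← hxq l]) j
  have hq₂ : ∀ l, q₂ l =ᵐ[G.μ] q₁ l := fun l => by
    filter_upwards [hae] with x hx
    exact (congrFun hx l).symm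
  have e₂ : G.redCost q₂ = G.redCost q₁ := redCost_congr hq₂
  refine ⟨q₂, ⟨⟨fun l => (hc₁.aemeasurable l).congr (hq₂ l).symm,
    fun x _ => leastArgmin_mem_stdSimplex _⟩, fun x _ l hl j => ?_⟩, fun x l => by rw [e₂]⟩
  rw [e₂]
  exact (lt_of_leastArgmin_ne_zero hl).2 j

end Existence

end BoardingGame

/-! ### Thresholds and their uniqueness -/

theorem lt_of_forall_lt_succ {L : ℕ} {w : ℕ → ℝ} (hlt : ∀ l < L, w l < w (l + 1))
    {i j : ℕ} (hij : i < j) (hj : j ≤ L) : w i < w j := by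
  induction j, hij using Nat.le_induction with
  | base => exact hlt i hj
  | succ j _ ih => exact (ih (Nat.le_of_succ_le hj)).trans (hlt j hj)

theorem eq_of_mem_consecutive {L : ℕ} {w : ℕ → ℝ} (hlt : ∀ l < L, w l < w (l + 1))
    {i j : ℕ} (hi : i < L) (hj : j < L) {x : ℝ} (hxi : x ∈ Ioo (w i) (w (i + 1)))
    (hxj : x ∈ Icc (w j) (w (j + 1))) : i = j := by
  rcases lt_trichotomy i j with h | h | h
  · have h3 : w (i + 1) ≤ w j := by
      rcases (Nat.succ_le_of_lt h).eq_or_lt with h' | h'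
      · exact (congrArg w h').le
      · exact (lt_of_forall_lt_succ hlt h' hj.le).le
    exact absurd (h3.trans hxj.1) hxi.2.not_ge
  · exact h
  · have h3 : w (j + 1) ≤ w i := by
      rcases (Nat.succ_le_of_lt h).eq_or_lt with h' | h'
      · exact (congrArg w h').le
      · exact (lt_of_forall_lt_succ hlt h' hi.le).le
    exact absurd (hxj.2.trans h3) hxi.1.not_ge

namespace BoardingGame

section Threshold

variable {L : ℕ} [NeZero L] {G : BoardingGame L} {q : Fin L → ℝ → ℝ} {w : ℕ → ℝ}

variable (G) in
/-- `w 0 ≤ … ≤ w L` are the end points of `[A, B]` and the types at which adjacent queues have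
equal costs. -/
structure IsThreshold (q : Fin L → ℝ → ℝ) (w : ℕ → ℝ) : Prop where
  zero : w 0 = G.A
  last : w L = G.B
  mem : ∀ l (_ : l + 1 < L), w (l + 1) ∈ Icc G.A G.B
  eq : ∀ l (h : l + 1 < L), G.redCost q ⟨l, Nat.lt_of_succ_lt h⟩ (w (l + 1))
    = G.redCost q ⟨l + 1, h⟩ (w (l + 1))

theorem IsChoice.exists_isThreshold (hq : G.IsChoice q) (h1 : G.A1) (h2 : G.A2)
    (hB : ∀ (l : ℕ) (h : l + 1 < L), G.m G.B * (G.P ⟨l + 1, h⟩ - G.P ⟨l, Nat.lt_of_succ_lt h⟩)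
      < G.N * ∫ x, q ⟨l, Nat.lt_of_succ_lt h⟩ x ∂G.μ) : ∃ w, G.IsThreshold q w := by
  have hex : ∀ l, ∃ z, ∀ h : l + 1 < L, z ∈ Icc G.A G.B ∧
      G.redCost q ⟨l, Nat.lt_of_succ_lt h⟩ z = G.redCost q ⟨l + 1, h⟩ z := by
    intro l
    by_cases h : l + 1 < L
    · have hc := (hq.continuousOn_redCost h1 ⟨l + 1, h⟩).sub
        (hq.continuousOn_redCost h1 ⟨l, Nat.lt_of_succ_lt h⟩)
      have hA := hq.redCost_lt_left h2 l h
      have hB' := hq.redCost_right_sub l h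
      have hBl := hB l h
      obtain ⟨z, hz, hz0⟩ := intermediate_value_Icc' G.A_lt_B.le hc (show (0 : ℝ) ∈ _ from
        ⟨by rw [Pi.sub_apply]; linarith, by rw [Pi.sub_apply]; linarith⟩)
      exact ⟨z, fun _ => ⟨hz, (sub_eq_zero.1 hz0).symm⟩⟩
    · exact ⟨0, fun h' => absurd h' h⟩
  choose z hz using hex
  have hL : L ≠ 0 := NeZero.ne L
  -- The crossing `z l` of queues `l` and `l + 1` becomes threshold `l + 1`; values beyond `L` play
  -- no role.
  refine ⟨fun i => if i = 0 then G.A else if i = L then G.B else z (i - 1), ?_, ?_, ?_, ?_⟩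
  · simp
  · simp [hL]
  · intro l h
    simpa [h.ne] using (hz l h).1
  · intro l h
    simpa [h.ne] using (hz l h).2

namespace IsThreshold

theorem mem_Icc (hw : G.IsThreshold q w) {i : ℕ} (hi : i ≤ L) : w i ∈ Icc G.A G.B := by
  rcases i with _ | l
  · rw [hw.zero]
    exact G.left_mem
  · rcases hi.eq_or_lt with h | h
    · rw [h, hw.last]
      exact G.right_mem
    · exact hw.mem l h

theorem redCost_lt (hw : G.IsThreshold q w) (hq : G.IsChoice q) (h1 : G.A1) (h2 : G.A2) {l : ℕ}
    (h : l + 1 < L) {x : ℝ} (hx : x ∈ Icc G.A G.B) (hxw : x < w (l + 1)) :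
    G.redCost q ⟨l, Nat.lt_of_succ_lt h⟩ x < G.redCost q ⟨l + 1, h⟩ x := by
  have h3 := hq.strictAntiOn_redCost_succ_sub h1 h2 l h hx (hw.mem l h) hxw
  simp only at h3
  linarith [hw.eq l h]

theorem lt_redCost (hw : G.IsThreshold q w) (hq : G.IsChoice q) (h1 : G.A1) (h2 : G.A2) {l : ℕ}
    (h : l + 1 < L) {x : ℝ} (hx : x ∈ Icc G.A G.B) (hxw : w (l + 1) < x) :
    G.redCost q ⟨l + 1, h⟩ x < G.redCost q ⟨l, Nat.lt_of_succ_lt h⟩ x := by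
  have h3 := hq.strictAntiOn_redCost_succ_sub h1 h2 l h (hw.mem l h) hx hxw
  simp only at h3
  linarith [hw.eq l h]

theorem redCost_eq_iff (hw : G.IsThreshold q w) (hq : G.IsChoice q) (h1 : G.A1) (h2 : G.A2)
    {l : ℕ} (h : l + 1 < L) {x : ℝ} (hx : x ∈ Icc G.A G.B) :
    G.redCost q ⟨l, Nat.lt_of_succ_lt h⟩ x = G.redCost q ⟨l + 1, h⟩ x ↔ x = w (l + 1) := by
  constructor
  · intro he
    rcases lt_trichotomy x (w (l + 1)) with hlt | heq | hlt
    · exact absurd he (hw.redCost_lt hq h1 h2 h hx hlt).ne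
    · exact heq
    · exact absurd he (hw.lt_redCost hq h1 h2 h hx hlt).ne'
  · rintro rfl
    exact hw.eq l h

/-- Only the types between two consecutive thresholds join a queue. -/
theorem mem_of_ne_zero (hw : G.IsThreshold q w) (hq : G.IsReducedNash q) (h1 : G.A1) (h2 : G.A2)
    {l : Fin L} {x : ℝ} (hx : x ∈ Icc G.A G.B) (hl : q l x ≠ 0) :
    x ∈ Icc (w l) (w (l + 1)) := by
  have hopt := hq.le_of_ne_zero x hx l hl
  obtain ⟨l, hlL⟩ := l
  constructor
  · rcases l with _ | k
    · simp only [hw.zero]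
      exact hx.1
    · by_contra! hc
      exact (hw.redCost_lt hq.toIsChoice h1 h2 hlL hx hc).not_ge (hopt _)
  · rcases (Nat.succ_le_of_lt hlL).eq_or_lt with h | h
    · simp only at h ⊢
      rw [show l + 1 = L from h, hw.last]
      exact hx.2
    · by_contra! hc
      exact (hw.lt_redCost hq.toIsChoice h1 h2 h hx hc).not_ge (hopt _)

/-- Otherwise at most the single type `w l` could join queue `l`, which would then be empty. -/
theorem lt_succ (hw : G.IsThreshold q w) (hq : G.IsReducedNash q) (h1 : G.A1) (h2 : G.A2)
    (hocc : ∀ l, 0 < ∫ x, q l x ∂G.μ) {l : ℕ} (hl : l < L) : w l < w (l + 1) := by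
  by_contra! hc
  refine (hocc ⟨l, hl⟩).ne' ?_
  refine integral_eq_zero_of_ae ?_
  have hne : ∀ᵐ x ∂G.μ, x ≠ w l := by
    rw [ae_iff]
    simp
  filter_upwards [G.ae_mem_Icc, hne] with x hx hxw
  by_contra h
  have h3 := hw.mem_of_ne_zero hq h1 h2 hx h
  exact hxw (le_antisymm (h3.2.trans hc) h3.1)

/-- Off the thresholds, the queue choices are the pure threshold choices. -/
theorem eq_indicator (hw : G.IsThreshold q w) (hq : G.IsReducedNash q) (h1 : G.A1) (h2 : G.A2)
    (hlt : ∀ l < L, w l < w (l + 1)) {x : ℝ} (hx : x ∈ Icc G.A G.B)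
    (hne : ∀ l < L, x ≠ w l) (l : Fin L) :
    q l x = (Ioc (w l) (w (l + 1))).indicator 1 x := by
  have hsupp : ∀ j : Fin L, q j x ≠ 0 → x ∈ Ioc (w j) (w (j + 1)) := fun j hj => by
    have h := hw.mem_of_ne_zero hq h1 h2 hx hj
    exact ⟨lt_of_le_of_ne h.1 (hne j j.2).symm, h.2⟩
  by_cases hxl : x ∈ Ioc (w l) (w (l + 1))
  · rw [indicator_of_mem hxl]
    refine stdSimplex_eq_one (hq.mem x hx) fun j hj => ?_
    by_contra hc
    have hxj := hsupp j hc
    refine hj (Fin.ext ?_)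
    -- Only thresholds of index below `L` are excluded, so `x = w (l + 1)` remains possible when `l`
    -- is the top queue and `x = B`.
    rcases hxl.2.eq_or_lt with h | h
    · rcases (Nat.succ_le_of_lt l.2).eq_or_lt with h' | h'
      · rcases hxj.2.eq_or_lt with h'' | h''
        · by_contra hjl
          have : (j : ℕ) + 1 < l + 1 := by have := j.2; omega
          have := lt_of_forall_lt_succ hlt this l.2
          linarith
        · exact eq_of_mem_consecutive hlt j.2 l.2 ⟨hxj.1, h''⟩ ⟨hxl.1.le, hxl.2⟩
      · exact absurd h (hne _ h')
    · exact (eq_of_mem_consecutive hlt l.2 j.2 ⟨hxl.1, h⟩ ⟨hxj.1.le, hxj.2⟩).symm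
  · rw [indicator_of_notMem hxl]
    by_contra hc
    exact hxl (hsupp l hc)

theorem ae_eq_indicator (hw : G.IsThreshold q w) (hq : G.IsReducedNash q) (h1 : G.A1) (h2 : G.A2)
    (hlt : ∀ l < L, w l < w (l + 1)) (l : Fin L) :
    q l =ᵐ[G.μ] (Ioc (w l) (w (l + 1))).indicator 1 := by
  have hne : ∀ᵐ x ∂G.μ, ∀ i, x ≠ w i := by
    refine ae_all_iff.2 fun i => ?_
    rw [ae_iff]
    simp
  filter_upwards [G.ae_mem_Icc, hne] with x hx hxw
  exact hw.eq_indicator hq h1 h2 hlt hx (fun i _ => hxw i) l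

end IsThreshold

section Interval

variable {f : ℝ → ℝ} {a b v : ℝ}

theorem setIntegral_mul_of_ae_eq_indicator (hfe : f =ᵐ[G.μ] (Ioc a b).indicator 1) (k : ℝ → ℝ)
    {s : Set ℝ} (hs : MeasurableSet s) :
    ∫ x in s, f x * k x ∂G.μ = ∫ x in s ∩ Ioc a b, k x ∂G.μ := by
  rw [← setIntegral_indicator measurableSet_Ioc]
  refine setIntegral_congr_ae hs ?_
  filter_upwards [hfe] with x hx _
  rw [hx]
  by_cases h : x ∈ Ioc a b
  · simp [indicator_of_mem h]
  · simp [indicator_of_notMem h]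

theorem load_sub_integral_of_interval (hf : G.IsShare f) (h1 : G.A1)
    (hfe : f =ᵐ[G.μ] (Ioc a b).indicator 1) (hab : a ≤ b) (ha : a ∈ Icc G.A G.B) :
    G.load f a - ∫ x, f x ∂G.μ = G.n a * (G.tail (fun _ => 1) a - G.tail (fun _ => 1) b)
      - (G.cum (fun _ => 1) b - G.cum (fun _ => 1) a) := by
  have e1 : ∫ x, f x ∂G.μ = G.cum (fun _ => 1) b - G.cum (fun _ => 1) a := by
    have h := setIntegral_mul_of_ae_eq_indicator hfe (fun _ => 1) MeasurableSet.univ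
    simp only [mul_one, Measure.restrict_univ, univ_inter] at h
    rw [h, isShare_one.cum_sub hab]
  have e2 : G.cum f a = 0 := by
    have h := setIntegral_mul_of_ae_eq_indicator hfe (fun _ => 1) (measurableSet_Iic (a := a))
    simp only [mul_one] at h
    rw [cum, h, show Iic a ∩ Ioc a b = ∅ from ?_, setIntegral_empty]
    exact eq_empty_of_forall_notMem fun x hx => hx.2.1.not_ge hx.1
  have e3 : G.tail f a = G.tail (fun _ => 1) a - G.tail (fun _ => 1) b := by
    rw [tail, setIntegral_mul_of_ae_eq_indicator hfe _ measurableSet_Ioi,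
      isShare_one.tail_sub h1 hab, inter_eq_self_of_subset_right Ioc_subset_Ioi_self]
    simp only [one_mul]
  rw [hf.load_eq ha, e1, e2, e3, zero_add]

theorem load_right_of_interval (hf : G.IsShare f)
    (hfe : f =ᵐ[G.μ] (Ioc a b).indicator 1) (hab : a ≤ b) (hb : b ∈ Icc G.A G.B) :
    G.load f b = G.cum (fun _ => 1) b - G.cum (fun _ => 1) a := by
  have e2 : G.cum f b = G.cum (fun _ => 1) b - G.cum (fun _ => 1) a := by
    have h := setIntegral_mul_of_ae_eq_indicator hfe (fun _ => 1) (measurableSet_Iic (a := b))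
    simp only [mul_one] at h
    rw [cum, h, isShare_one.cum_sub hab, inter_eq_self_of_subset_right Ioc_subset_Iic_self]
  have e3 : G.tail f b = 0 := by
    rw [tail, setIntegral_mul_of_ae_eq_indicator hfe _ measurableSet_Ioi,
      show Ioi b ∩ Ioc a b = ∅ from ?_, setIntegral_empty]
    exact eq_empty_of_forall_notMem fun x hx => hx.2.2.not_gt hx.1
  rw [hf.load_eq hb, e2, e3, mul_zero, add_zero]

end Interval

variable (G) in
/-- `N` times the mass that queue `l` must have if its upper threshold is `a` and the next one
is `b`. -/
noncomputable def massBelow (l : ℕ) (h : l + 1 < L) (a b : ℝ) : ℝ :=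
  G.m a * (G.P ⟨l + 1, h⟩ - G.P ⟨l, Nat.lt_of_succ_lt h⟩)
    + G.N * (G.n a * (G.tail (fun _ => 1) a - G.tail (fun _ => 1) b)
      - (G.cum (fun _ => 1) b - G.cum (fun _ => 1) a))

/-- Up to a factor `N` on the subtracted part, `massBelow` is the strictly decreasing
price-plus-load function at `a` minus `cum b + n a * tail b`, taken for the whole population. The
latter increases in `a`, and in `b` as long as `a ≤ b`. -/
theorem massBelow_lt (h1 : G.A1) (h2 : G.A2) {l : ℕ} (h : l + 1 < L) {a a' b b' : ℝ}
    (ha : a ∈ Icc G.A G.B) (ha' : a' ∈ Icc G.A G.B) (hb : b ∈ Icc G.A G.B)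
    (hb' : b' ∈ Icc G.A G.B) (hab : a ≤ b) (haa : a < a') (hbb : b ≤ b') :
    G.massBelow l h a' b' < G.massBelow l h a b := by
  have h3 := strictAntiOn_price_add_load h1 h2 l h ha ha' haa
  simp only at h3
  rw [isShare_one.load_eq ha, isShare_one.load_eq ha'] at h3
  have h4 := (isShare_one.cum_sub_bounds h1 hb hb' hbb).1
  have h5 : 0 ≤ (G.n b - G.n a) * (G.tail (fun _ => 1) b - G.tail (fun _ => 1) b') :=
    mul_nonneg (sub_nonneg.2 (G.n_strictMono.monotoneOn ha hb hab))
      (sub_nonneg.2 (isShare_one.tail_anti h1 hbb))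
  have h6 : 0 ≤ (G.n a' - G.n a) * G.tail (fun _ => 1) b' :=
    mul_nonneg (sub_nonneg.2 (G.n_strictMono.monotoneOn ha ha' haa.le))
      (isShare_one.tail_nonneg b')
  have h7 : 0 ≤ G.N * (G.cum (fun _ => 1) b' - G.cum (fun _ => 1) b
      - G.n a * (G.tail (fun _ => 1) b - G.tail (fun _ => 1) b')) :=
    mul_nonneg G.N_pos.le (by linarith)
  have h8 := mul_nonneg G.N_pos.le h6
  unfold massBelow
  linarith

namespace IsThreshold

/-- Solve the indifference at `w (l + 1)` for the load of queue `l`, which at its upper threshold is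
its whole mass. -/
theorem massBelow_eq (hw : G.IsThreshold q w) (hq : G.IsReducedNash q) (h1 : G.A1) (h2 : G.A2)
    (hlt : ∀ l < L, w l < w (l + 1)) {l : ℕ} (h : l + 1 < L) :
    G.massBelow l h (w (l + 1)) (w (l + 2))
      = G.N * (G.cum (fun _ => 1) (w (l + 1)) - G.cum (fun _ => 1) (w l)) := by
  have h3 := redCost_succ_sub (G := G) (q := q) l h (w (l + 1))
  rw [hw.eq l h, sub_self, load_sub_integral_of_interval (hq.isShare _) h1
    (hw.ae_eq_indicator hq h1 h2 hlt ⟨l + 1, h⟩) (hlt _ h).le (hw.mem l h),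
    load_right_of_interval (hq.isShare _)
    (hw.ae_eq_indicator hq h1 h2 hlt ⟨l, Nat.lt_of_succ_lt h⟩)
    (hlt _ (Nat.lt_of_succ_lt h)).le (hw.mem l h)] at h3
  unfold massBelow
  linarith

variable {q' : Fin L → ℝ → ℝ} {w' : ℕ → ℝ}

/-- Larger thresholds force less mass into the queue below, so its lower threshold must be larger as
well. The strict inequality travels down to index `0`, where both thresholds are `A`. -/
theorem not_lt_of_le_succ (hw : G.IsThreshold q w) (hw' : G.IsThreshold q' w')
    (hq : G.IsReducedNash q) (hq' : G.IsReducedNash q') (h1 : G.A1) (h2 : G.A2)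
    (hlt : ∀ l < L, w l < w (l + 1)) (hlt' : ∀ l < L, w' l < w' (l + 1)) {i : ℕ} (hi : i < L)
    (h : w (i + 1) ≤ w' (i + 1)) : ¬w i < w' i := by
  induction i with
  | zero =>
    rw [hw.zero, hw'.zero]
    exact lt_irrefl _
  | succ k ih =>
    intro hk
    refine ih (Nat.lt_of_succ_lt hi) hk.le ?_
    have h3 := massBelow_lt h1 h2 hi (hw.mem k hi) (hw'.mem k hi) (hw.mem_Icc hi) (hw'.mem_Icc hi)
      (hlt _ hi).le hk h
    rw [hw.massBelow_eq hq h1 h2 hlt hi, hw'.massBelow_eq hq' h1 h2 hlt' hi] at h3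
    have h4 := lt_of_mul_lt_mul_left h3 G.N_pos.le
    have h5 : G.cum (fun _ => 1) (w (k + 1)) ≤ G.cum (fun _ => 1) (w' (k + 1)) :=
      isShare_one.cum_mono hk.le
    by_contra! hc
    have h6 : G.cum (fun _ => 1) (w' k) ≤ G.cum (fun _ => 1) (w k) := isShare_one.cum_mono hc
    linarith

theorem unique (hw : G.IsThreshold q w) (hw' : G.IsThreshold q' w')
    (hq : G.IsReducedNash q) (hq' : G.IsReducedNash q') (h1 : G.A1) (h2 : G.A2)
    (hlt : ∀ l < L, w l < w (l + 1)) (hlt' : ∀ l < L, w' l < w' (l + 1)) {i : ℕ} (hi : i ≤ L) :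
    w i = w' i := by
  refine Nat.decreasingInduction (motive := fun i _ => w i = w' i) (fun k hk ih => ?_) ?_ hi
  · exact le_antisymm (not_lt.1 (hw'.not_lt_of_le_succ hw hq' hq h1 h2 hlt' hlt hk ih.ge))
      (not_lt.1 (hw.not_lt_of_le_succ hw' hq hq' h1 h2 hlt hlt' hk ih.le))
  · rw [hw.last, hw'.last]

end IsThreshold

theorem IsNash.exists_isThreshold {σ : Policy L} (hσ : G.IsNash σ) (h1 : G.A1) (h2 : G.A2)
    (h3 : G.A3) : ∃ w, G.IsThreshold σ.q w ∧ ∀ l < L, w l < w (l + 1) := by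
  obtain ⟨hocc, hB⟩ := h3 σ hσ
  simp only [hσ.F_zero] at hocc hB
  obtain ⟨w, hw⟩ := hσ.isChoice.exists_isThreshold h1 h2 hB
  exact ⟨w, hw, fun l hl => hw.lt_succ (hσ.isReducedNash h1) h1 h2 hocc hl⟩

/-- At the threshold `w (k + 1)` queues `k` and `k + 1` tie, and the rule of the first minimizer
picks `k`. This matches intervals closed on the right. -/
theorem IsThreshold.eq_indicator_of_leastArgmin (hw : G.IsThreshold q w) (hq : G.IsReducedNash q)
    (h1 : G.A1) (h2 : G.A2) (hlt : ∀ l < L, w l < w (l + 1))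
    (hleast : ∀ x l, q l x = leastArgmin (fun j => G.redCost q j x) l) {x : ℝ}
    (hx : x ∈ Ioc G.A G.B) (l : Fin L) : q l x = (Ioc (w l) (w (l + 1))).indicator 1 x := by
  by_cases hne : ∀ i < L, x ≠ w i
  · exact hw.eq_indicator hq h1 h2 hlt (Ioc_subset_Icc_self hx) hne l
  push Not at hne
  obtain ⟨i, hi, rfl⟩ := hne
  rcases i with _ | k
  · rw [hw.zero] at hx
    exact absurd hx.1 (lt_irrefl _)
  have hk : k < L := Nat.lt_of_succ_lt hi
  have hzero : ∀ j : Fin L, (j : ℕ) ≠ k → q j (w (k + 1)) = 0 := by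
    intro j hj
    by_contra hc
    have h3 := hw.mem_of_ne_zero hq h1 h2 (Ioc_subset_Icc_self hx) hc
    rcases lt_or_gt_of_ne hj with h | h
    · have := lt_of_forall_lt_succ hlt (Nat.succ_lt_succ h) hi.le
      exact this.not_ge h3.2
    · rcases (Nat.succ_le_of_lt h).eq_or_lt with h' | h'
      · have hj' : j = ⟨k + 1, hi⟩ := Fin.ext h'.symm
        rw [hleast] at hc
        have h4 := (lt_of_leastArgmin_ne_zero hc).1 ⟨k, hk⟩ (by simpa [Fin.lt_def] using h)
        subst hj'
        exact h4.ne (hw.eq k hi).symm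
      · have := lt_of_forall_lt_succ hlt h' j.2.le
        exact this.not_ge h3.1
  by_cases hl : (l : ℕ) = k
  · have hxl : w (k + 1) ∈ Ioc (w l) (w (l + 1)) := by
      rw [hl]
      exact ⟨hlt k hk, le_rfl⟩
    rw [indicator_of_mem hxl]
    refine stdSimplex_eq_one (hq.mem _ (Ioc_subset_Icc_self hx)) fun j hj => ?_
    exact hzero j fun h => hj (Fin.ext (h.trans hl.symm))
  · rw [hzero l hl, indicator_of_notMem]
    intro h
    rcases lt_or_gt_of_ne hl with h' | h'
    · have := lt_of_forall_lt_succ hlt (Nat.succ_lt_succ h') hi.le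
      exact this.not_ge h.2
    · rcases (Nat.succ_le_of_lt h').eq_or_lt with h'' | h''
      · exact h.1.ne (congrArg w h''.symm)
      · have := lt_of_forall_lt_succ hlt h'' l.2.le
        exact this.not_gt h.1

end Threshold

end BoardingGame

theorem mainTheorem2 {L : ℕ} [NeZero L] (G : BoardingGame L) (hg : G.WaitRange)
    (h1 : G.A1) (h2 : G.A2) (h3 : G.A3) :
    ∃ v : Fin (L + 1) → ℝ,
      v 0 = G.A ∧ v (Fin.last L) = G.B ∧ StrictMono v ∧
      -- there is an equilibrium, in pure threshold strategies
      (∃ σ : Policy L, G.IsNash σ ∧ ∀ x ∈ Set.Ioc G.A G.B, ∀ l : Fin L,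
        σ.q l x = (Set.Ioc (v l.castSucc) (v l.succ)).indicator 1 x) ∧
      -- every equilibrium is this one, up to the choice of the indifferent threshold types
      (∀ σ : Policy L, G.IsNash σ →
        (∀ x ∈ Set.Icc G.A G.B, (∀ l : Fin L, x ≠ v l.castSucc) → ∀ l : Fin L,
          σ.q l x = (Set.Ioc (v l.castSucc) (v l.succ)).indicator 1 x) ∧
        (∀ x ∈ Set.Icc G.A G.B, ∀ l : Fin L,
          σ.q l x ≠ 0 → x ∈ Set.Icc (v l.castSucc) (v l.succ)) ∧
        -- the threshold between two adjacent queues is the only crossing point of their costs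
        (∀ (l : ℕ) (h : l + 1 < L), ∀ x ∈ Set.Icc G.A G.B,
          (G.joinCost σ ⟨l, Nat.lt_of_succ_lt h⟩ x = G.joinCost σ ⟨l + 1, h⟩ x ↔
            x = v ⟨l + 1, Nat.lt_succ_of_lt h⟩))) ∧
      (∀ σ τ : Policy L, G.IsNash σ → G.IsNash τ →
        ∀ l : Fin L, ∀ x ∈ Set.Icc G.A G.B, 0 < G.n x → σ.T l x = τ.T l x) := by
  obtain ⟨q, hq, hleast⟩ := BoardingGame.exists_isReducedNash h1 h2
  obtain ⟨σ₀, hσ₀, rfl⟩ := hq.exists_isNash hg h1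
  obtain ⟨w, hw, hlt⟩ := hσ₀.exists_isThreshold h1 h2 h3
  -- The thresholds `w` of the constructed equilibrium serve every equilibrium.
  have hall : ∀ σ : Policy L, G.IsNash σ → G.IsThreshold σ.q w := by
    intro σ hσ
    obtain ⟨w', hw', hlt'⟩ := hσ.exists_isThreshold h1 h2 h3
    have he : ∀ i ≤ L, w i = w' i := fun i hi =>
      hw.unique hw' hq (hσ.isReducedNash h1) h1 h2 hlt hlt' hi
    refine ⟨hw.zero, hw.last, hw.mem, fun l h => ?_⟩
    rw [he _ h.le]
    exact hw'.eq l h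
  refine ⟨fun i => w i, hw.zero, hw.last, fun i j hij =>
    lt_of_forall_lt_succ hlt hij (Nat.le_of_lt_succ j.2),
    ⟨σ₀, hσ₀, fun x hx l => hw.eq_indicator_of_leastArgmin hq h1 h2 hlt hleast hx l⟩,
    fun σ hσ => ⟨fun x hx hne l => ?_, fun x hx l hl => ?_, fun l h x hx => ?_⟩,
    fun σ τ hσ hτ l x hx hn => ?_⟩
  · exact (hall σ hσ).eq_indicator (hσ.isReducedNash h1) h1 h2 hlt hx
      (fun i hi => hne ⟨i, hi⟩) l
  · exact (hall σ hσ).mem_of_ne_zero (hσ.isReducedNash h1) h1 h2 hx hl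
  · rw [hσ.joinCost_eq h1 _ hx, hσ.joinCost_eq h1 _ hx]
    exact (hall σ hσ).redCost_eq_iff hσ.isChoice h1 h2 h hx
  · exact hσ.T_eq_of_q_ae_eq hτ h1
      (((hall σ hσ).ae_eq_indicator (hσ.isReducedNash h1) h1 h2 hlt l).trans
        ((hall τ hτ).ae_eq_indicator (hτ.isReducedNash h1) h1 h2 hlt l).symm) hx hn
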